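/- **Definitions.** Graphs are simple and may be infinite. A *separation* of a graph $G$ is an ordered pair $(A,B)$ of vertex sets with $A\cup B=V(G)$ and no edge between $A\setminus B$ and $B\setminus A$; its *order* is $|A\cap B|$. Write $(C,D)\le(A,B)$ if $C\subseteq A$ and $B\subseteq D$. A *profile* is a set $P$ of separations of $G$ such that * (P1) if $(A,B)\in P$ and $(C,D)\le(A,B)$, then $(D,C)\notin P$; * (P2) if $(A,B),(C,D)\in P$, then $(B\cap D,A\cup C)\notin P$. For $\ell\in\mathbb N$, it is an *$\ell$-profile* if all its elements have order less than $\ell$ and for every separation $(A,B)$ of $G$ of order less than $\ell$ it contains $(A,B)$ or $(B,A)$. It is *principal* if $\bigcap_{i\in I}(B_i\setminus A_i)\ne\emptyset$ for every family $((A_i,B_i))_{i\in I}$ in $P$ all of whose members have the same separator $A_i\cap B_i$. It is *robust* if for every $(A,B)\in P$ and every separation $(C,D)$ of finite order such that $(B\cap C,A\cup D)$ and $(B\cap D,A\cup C)$ both have order less than $|A\cap B|$, one of these two separations is not in $P$. A separation $(A,B)$ *distinguishes* $P$ and $Q$ if one of them contains $(A,B)$ and the other contains $(B,A)$; $P$ and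 $Q$ are *$k$-distinguishable* if some separation of order at most $k$ distinguishes them. For a set $\mathcal P$ of profiles of $G$, let $\kappa(\mathcal P,G)$ be the minimum order of a separation distinguishing two elements of $\mathcal P$ ($\infty$ if there is no such separation of finite order). The graph $G$ is *well-separable* with respect to $\mathcal P$ if for every separation $(A,B)$ of finite order at most $\kappa(\mathcal P,G)$ that distinguishes two elements of $\mathcal P$, there is no component $C$ of $G-(A\cap B)$ whose neighbourhood $N(C)$ is a proper subset of $A\cap B$. A *tree-decomposition* of $G$ is a pair $(T,(V_t)_{t\in V(T)})$ of a tree $T$ and sets $V_t\subseteq V(G)$ such that every vertex of $G$ lies in some $V_t$, both ends of every edge of $G$ lie in a common $V_t$, and $V_{t_1}\cap V_{t_3}\subseteq V_{t_2}$ whenever $t_2$ lies on the path of $T$ from $t_1$ to $t_3$. It is *$k$-balanced* if $|V_s\cap V_t|=k$ for every edge $st$ of $T$. An edge $e$ of $T$ *induces* the separation $(\bigcup_{t\in V(T_1)}V_t,\bigcup_{t\in V(T_2)}V_t)$ and its reverse, where $T_1,T_2$ are the components of $T-e$; the tree-decomposition *distinguishes* $P$ and $Q$ if some separation induced by an edge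 of $T$ distinguishes them. An isomorphism $(G,\mathcal P)\to(G',\mathcal P')$ is a graph isomorphism $G\to G'$ that maps $\mathcal P$ onto $\mathcal P'$. A construction assigning to each pair $(G,\mathcal P)$ a tree-decomposition $(T(G,\mathcal P),(V_t)_t)$ of $G$ is *canonical* if it commutes with all isomorphisms of pairs, that is, if one can assign to every isomorphism $\varphi:(G,\mathcal P)\to(G',\mathcal P')$ a tree isomorphism $\theta_\varphi:T(G,\mathcal P)\to T(G',\mathcal P')$ with $V_{\theta_\varphi(t)}=\varphi(V_t)$ for all nodes $t$, such that $\theta_{\mathrm{id}}=\mathrm{id}$ and $\theta_{\chi\circ\varphi}=\theta_\chi\circ\theta_\varphi$. **Theorem.** There is a canonical construction that assigns to every pair $(G,\mathcal P)$ of a graph $G$ and a set $\mathcal P$ of sets of separations of $G$ a tree-decomposition of $G$ such that the following holds. Let $k\in\mathbb N$, let $k=\kappa(\mathcal P,G)$, let $\mathcal P$ be a set of robust principal $(k+1)$-profiles of $G$, and let $G$ be well-separable with respect to $\mathcal P$. Then the tree-decomposition assigned to $(G,\mathcal P)$ 1. distinguishes any two $k$-distinguishable profiles in $\mathcal P$,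 and 2. is $k$-balanced. -/

import Mathlib

universe u

namespace GraphSep

section Separations

variable {V : Type u} {G : SimpleGraph V}

/-- A separation `(A, B)` of `G`: vertex sets `A = left`, `B = right` with `G[A] ∪ G[B] = G`. -/
@[ext]
structure Separation (G : SimpleGraph V) where
  left : Set V
  right : Set V
  cover : left ∪ right = Set.univ
  no_edge : ∀ a ∈ left \ right, ∀ b ∈ right \ left, ¬ G.Adj a b

namespace Separation

/-- The reversed separation `(B, A)`. -/
def flip (s : Separation G) : Separation G where
  left := s.right
  right := s.left
  cover := by rw [Set.union_comm]; exact s.cover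
  no_edge := fun a ha b hb h => s.no_edge b hb a ha h.symm

/-- `(A, B) ≤ (C, D)` iff `A ⊆ C` and `D ⊆ B`. -/
instance : LE (Separation G) :=
  ⟨fun s t => s.left ⊆ t.left ∧ t.right ⊆ s.right⟩

/-- The separator `A ∩ B`. -/
def separator (s : Separation G) : Set V := s.left ∩ s.right

/-- The order `|A ∩ B|` (`⊤` if the separator is infinite). -/
noncomputable def order (s : Separation G) : ℕ∞ := s.separator.encard

/-- The corner separation `(A ∩ C, B ∪ D)` of `(A, B)` and `(C, D)`. -/
def corner (s t : Separation G) : Separation G where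
  left := s.left ∩ t.left
  right := s.right ∪ t.right
  cover := by
    ext v
    have h1 : v ∈ s.left ∪ s.right := s.cover ▸ Set.mem_univ v
    have h2 : v ∈ t.left ∪ t.right := t.cover ▸ Set.mem_univ v
    simp only [Set.mem_union, Set.mem_inter_iff, Set.mem_univ, iff_true] at *
    tauto
  no_edge := by
    intro a ha b hb h
    have h1 := s.no_edge a
    have h2 := t.no_edge a
    have h3 : b ∈ s.left ∪ s.right := s.cover ▸ Set.mem_univ b
    have h4 : b ∈ t.left ∪ t.right := t.cover ▸ Set.mem_univ b
    simp only [Set.mem_union, Set.mem_inter_iff, Set.mem_sdiff] at *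
    by_cases hbs : b ∈ s.left
    · exact h2 ⟨ha.1.2, by tauto⟩ b (by tauto) h
    · exact h1 ⟨ha.1.1, by tauto⟩ b (by tauto) h

/-- The image `(φ(A), φ(B))` of a separation under a graph isomorphism. -/
def map {W : Type u} {H : SimpleGraph W} (φ : G ≃g H) (s : Separation G) : Separation H where
  left := φ '' s.left
  right := φ '' s.right
  cover := by
    rw [← Set.image_union, s.cover, Set.image_univ]
    exact φ.surjective.range_eq
  no_edge := by
    intro a ha b hb h
    rw [← Set.image_sdiff φ.injective] at ha hb
    obtain ⟨x, hx, rfl⟩ := ha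
    obtain ⟨y, hy, rfl⟩ := hb
    exact s.no_edge x hx y hy (φ.map_adj_iff.mp h)

end Separation

/-- `P` is a profile: it is consistent, (P1), and satisfies (P2):
`(A, B), (C, D) ∈ P` implies `(B ∩ D, A ∪ C) ∉ P`. -/
def IsProfile (P : Set (Separation G)) : Prop :=
  (∀ s t : Separation G, t ≤ s → s ∈ P → t.flip ∉ P) ∧
  (∀ s ∈ P, ∀ t ∈ P, s.flip.corner t.flip ∉ P)

/-- `P` is a `k`-profile: a profile of separations of order less than `k` that contains `(A, B)`
or `(B, A)` for every separation `(A, B)` of order less than `k`. -/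
def IsKProfile (k : ℕ) (P : Set (Separation G)) : Prop :=
  IsProfile P ∧ (∀ s ∈ P, s.order < k) ∧
    ∀ s : Separation G, s.order < k → s ∈ P ∨ s.flip ∈ P

/-- `P` is principal: any members `(Aᵢ, Bᵢ)` of `P` with a common separator satisfy
`⋂ (Bᵢ \ Aᵢ) ≠ ∅`. -/
def IsPrincipal (P : Set (Separation G)) : Prop :=
  ∀ F ⊆ P, (∀ s ∈ F, ∀ t ∈ F, s.separator = t.separator) →
    (⋂ s ∈ F, s.right \ s.left).Nonempty

/-- `P` is `n`-robust: for `(A, B) ∈ P` and any separation `(C, D)` of order at most `n`, if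
`(B ∩ C, A ∪ D)` and `(B ∩ D, A ∪ C)` both have order less than `|A ∩ B|`, then one of them
is not in `P`. -/
def IsNRobust (n : ℕ) (P : Set (Separation G)) : Prop :=
  ∀ s ∈ P, ∀ t : Separation G, t.order ≤ n →
    (s.flip.corner t).order < s.order → (s.flip.corner t.flip).order < s.order →
      s.flip.corner t ∉ P ∨ s.flip.corner t.flip ∉ P

/-- `P` is robust: it is `n`-robust for every `n`. -/
def IsRobust (P : Set (Separation G)) : Prop := ∀ n : ℕ, IsNRobust n P

/-- The separation `s = (A, B)` distinguishes `P` and `Q`: one of them contains `(A, B)` and the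
other one contains `(B, A)`. -/
def Separation.Distinguishes (s : Separation G) (P Q : Set (Separation G)) : Prop :=
  (s ∈ P ∧ s.flip ∈ Q) ∨ (s.flip ∈ P ∧ s ∈ Q)

/-- `P` and `Q` are `l`-distinguishable: a separation of order at most `l` distinguishes them. -/
def Distinguishable (l : ℕ) (P Q : Set (Separation G)) : Prop :=
  ∃ s : Separation G, s.order ≤ l ∧ s.Distinguishes P Q

/-- `κ(Ps, G)`: the minimum order of a separation of `G` that distinguishes two members of `Ps`
(`⊤` if there is no such separation of finite order). -/
noncomputable def kappa (Ps : Set (Set (Separation G))) : ℕ∞ :=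
  sInf {n : ℕ∞ | ∃ s : Separation G, s.order = n ∧ ∃ P ∈ Ps, ∃ Q ∈ Ps, s.Distinguishes P Q}

/-- `ℛ(k, Ps, G)`: the separations of finite order at most `k` that distinguish two members
of `Ps`. -/
def relevant (k : ℕ∞) (Ps : Set (Set (Separation G))) : Set (Separation G) :=
  {s | s.order ≤ k ∧ s.order < ⊤ ∧ ∃ P ∈ Ps, ∃ Q ∈ Ps, s.Distinguishes P Q}

/-- The neighbourhood `N(C)` of a vertex set `C`. -/
def nbhd (G : SimpleGraph V) (C : Set V) : Set V := {v | v ∉ C ∧ ∃ w ∈ C, G.Adj w v}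

/-- `𝒮(k, Ps, G)`: the separations `(C ∪ N(C), V(G) \ C)` where `C` is a degenerated component of
`G - (A ∩ B)`, that is `N(C) ⊊ A ∩ B`, for some relevant `(A, B)` of order at most `k`. -/
def degenerator (k : ℕ∞) (Ps : Set (Set (Separation G))) : Set (Separation G) :=
  {d | ∃ s ∈ relevant k Ps, ∃ C : G.ComponentCompl s.separator,
    nbhd G C.supp ⊂ s.separator ∧ d.left = C.supp ∪ nbhd G C.supp ∧ d.right = C.suppᶜ}

/-- `G` is well-separable with respect to `Ps`. -/
def WellSeparable (Ps : Set (Set (Separation G))) : Prop := degenerator (kappa Ps) Ps = ∅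

end Separations

section TreeDecompositions

/-- A tree-decomposition of `G`: a tree with one bag (part) for every node. -/
structure TreeDecomposition {V : Type u} (G : SimpleGraph V) where
  node : Type u
  tree : SimpleGraph node
  isTree : tree.IsTree
  bag : node → Set V
  cover_vertex : ∀ v : V, ∃ t, v ∈ bag t
  cover_edge : ∀ v w : V, G.Adj v w → ∃ t, v ∈ bag t ∧ w ∈ bag t
  path_inter : ∀ (t₁ t₂ t₃ : node) (p : tree.Walk t₁ t₃), p.IsPath → t₂ ∈ p.support →
    bag t₁ ∩ bag t₃ ⊆ bag t₂

variable {V : Type u} {G : SimpleGraph V}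

/-- The union of the bags of the nodes in the component containing `x` of the tree minus the
edge `xy`. -/
def TreeDecomposition.side (D : TreeDecomposition G) (x y : D.node) : Set V :=
  ⋃ t ∈ {t | (D.tree.deleteEdges {s(x, y)}).Reachable x t}, D.bag t

/-- `s` is a separation induced by an edge `xy` of the decomposition tree. -/
def TreeDecomposition.Induces (D : TreeDecomposition G) (s : Separation G) : Prop :=
  ∃ x y, D.tree.Adj x y ∧ s.left = D.side x y ∧ s.right = D.side y x

/-- The tree-decomposition distinguishes `P` and `Q`: one of its induced separations does. -/
def TreeDecomposition.Distinguishes (D : TreeDecomposition G) (P Q : Set (Separation G)) : Prop :=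
  ∃ s, D.Induces s ∧ s.Distinguishes P Q

/-- All adhesion sets have size `k`. -/
def TreeDecomposition.IsBalanced (D : TreeDecomposition G) (k : ℕ) : Prop :=
  ∀ x y, D.tree.Adj x y → (D.bag x ∩ D.bag y).encard = k

end TreeDecompositions

section Canonical

/-- A pair `(G, Ps)` of a graph and a set of sets of separations of it. -/
structure ProfiledGraph where
  V : Type u
  graph : SimpleGraph V
  profiles : Set (Set (Separation graph))

/-- An isomorphism of pairs `(G, Ps) → (G', Ps')`: a graph isomorphism taking `Ps` onto `Ps'`. -/
structure ProfiledGraph.Iso (X Y : ProfiledGraph.{u}) where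
  toIso : X.graph ≃g Y.graph
  map_profiles : (fun P => Separation.map toIso '' P) '' X.profiles = Y.profiles

/-- The identity of a pair. -/
def ProfiledGraph.Iso.refl (X : ProfiledGraph.{u}) : X.Iso X where
  toIso := RelIso.refl _
  map_profiles := by
    have h : ∀ s : Separation X.graph, Separation.map (RelIso.refl _) s = s := by
      intro s
      ext v <;> simp [Separation.map]
    simp [h]

/-- The composition of isomorphisms of pairs. -/
def ProfiledGraph.Iso.trans {X Y Z : ProfiledGraph.{u}} (φ : X.Iso Y) (χ : Y.Iso Z) :
    X.Iso Z where
  toIso := φ.toIso.trans χ.toIso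
  map_profiles := by
    have h : ∀ s : Separation X.graph,
        Separation.map (φ.toIso.trans χ.toIso) s
          = Separation.map χ.toIso (Separation.map φ.toIso s) := by
      intro s
      ext v <;> simp [Separation.map]
    rw [← χ.map_profiles, ← φ.map_profiles, Set.image_image]
    simp only [Set.image_image, h]

/-- A construction `ψ` of tree-decompositions is canonical: it commutes with all isomorphisms of
pairs `(G, Ps)`. That is, every isomorphism `φ` of pairs acts (functorially) on the decomposition
trees, by tree isomorphisms that map the node with part `U` to a node with part `φ(U)`. -/
def IsCanonical (ψ : (X : ProfiledGraph.{u}) → TreeDecomposition X.graph) : Prop :=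
  ∃ θ : (X Y : ProfiledGraph.{u}) → X.Iso Y → ((ψ X).tree ≃g (ψ Y).tree),
    (∀ X Y (φ : X.Iso Y) (t : (ψ X).node),
      (ψ Y).bag (θ X Y φ t) = φ.toIso '' (ψ X).bag t) ∧
    (∀ X, θ X X (ProfiledGraph.Iso.refl X) = RelIso.refl _) ∧
    (∀ X Y Z (φ : X.Iso Y) (χ : Y.Iso Z), θ X Z (φ.trans χ) = (θ X Y φ).trans (θ Y Z χ))

end Canonical

end GraphSep

/-! The whole argument is about separators. Well-separability makes every relevant separator S full:
each component of G - S has all of S in its neighbourhood (`WellSeparable.full`). For relevant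
separators, nestedness ("X does not separate two vertices of S") is therefore symmetric, and only
finitely many full sets of size k separate a given finite set (`finite_full_separating`). So every
relevant separator has a finite crossing number.

For every pair of profiles, keep all distinguishing separators of order k with the fewest crossings;
keeping every tie makes the choice canonical. If two kept separators crossed, a suitable pair of
opposite corners would distinguish the relevant pairs of profiles. As k is the minimum order,
submodularity forces both corners to have order k, and together they have fewer crossings
(`ncard_crossings_corner_lt`), against optimality (`not_separates_of_optSeps`).

A nested set N of full separators of equal finite size defines a tree. Its nodes are the elements S
of N and the blocks b, which are choices of a component at every element of N. Connectedness is an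
induction on the number of separating elements (`TreeLike.exists_reachable`); acyclicity holds
because each edge is the only one leaving the side `Towards`. The edge between S and b induces (S ∪
b(S), V \ b(S)). A principal profile singles out one component of G - S, so an edge at S
distinguishes whatever a separation with separator S does (`Admissible.distinguishes`). -/

namespace GraphSep

/-! ### Full separators, crossing and nestedness. -/

section Linked

variable {V : Type u} {G : SimpleGraph V}

/-- `u` and `v` lie in the same component of `G - X`. -/
def Linked (G : SimpleGraph V) (X : Set V) (u v : V) : Prop :=
  ∃ p : G.Walk u v, ∀ x ∈ p.support, x ∉ X

namespace Linked

variable {X Y : Set V} {u v w : V}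

lemma left (h : Linked G X u v) : u ∉ X := by
  obtain ⟨p, hp⟩ := h
  exact hp _ p.start_mem_support

lemma right (h : Linked G X u v) : v ∉ X := by
  obtain ⟨p, hp⟩ := h
  exact hp _ p.end_mem_support

lemma refl (h : u ∉ X) : Linked G X u u :=
  ⟨.nil, by simpa using h⟩

lemma symm (h : Linked G X u v) : Linked G X v u := by
  obtain ⟨p, hp⟩ := h
  exact ⟨p.reverse, by simpa using hp⟩

lemma trans (h : Linked G X u v) (h' : Linked G X v w) : Linked G X u w := by
  obtain ⟨p, hp⟩ := h
  obtain ⟨q, hq⟩ := h'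
  refine ⟨p.append q, fun x hx => ?_⟩
  rcases (SimpleGraph.Walk.mem_support_append_iff p q).1 hx with hx | hx
  exacts [hp x hx, hq x hx]

lemma of_adj (hu : u ∉ X) (hv : v ∉ X) (h : G.Adj u v) : Linked G X u v :=
  ⟨.cons h .nil, by simp [hu, hv]⟩

lemma mono (hXY : X ⊆ Y) (h : Linked G Y u v) : Linked G X u v := by
  obtain ⟨p, hp⟩ := h
  exact ⟨p, fun x hx hX => hp x hx (hXY hX)⟩

/-- A link in `G - X` whose component avoids `Y` is a link in `G - Y`. -/
lemma of_avoid (h : Linked G X u v) (hY : ∀ w, Linked G X u w → w ∉ Y) : Linked G Y u v := by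
  classical
  obtain ⟨p, hp⟩ := h
  refine ⟨p, fun x hx => hY x ⟨p.takeUntil x hx, fun y hy => hp y ?_⟩⟩
  exact SimpleGraph.Walk.support_takeUntil_subset_support p hx hy

lemma map {W : Type u} {H : SimpleGraph W} (φ : G ≃g H) (h : Linked G X u v) :
    Linked H (φ '' X) (φ u) (φ v) := by
  obtain ⟨p, hp⟩ := h
  refine ⟨p.map φ.toHom, fun x hx => ?_⟩
  rw [SimpleGraph.Walk.support_map, List.mem_map] at hx
  obtain ⟨y, hy, rfl⟩ := hx
  rintro ⟨z, hz, hzy⟩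
  exact hp y hy (φ.injective hzy ▸ hz)

lemma map_iff {W : Type u} {H : SimpleGraph W} (φ : G ≃g H) :
    Linked H (φ '' X) (φ u) (φ v) ↔ Linked G X u v := by
  refine ⟨fun h => ?_, map φ⟩
  have := h.map φ.symm
  simpa [Set.image_image] using this

end Linked

/-- `X` separates two elements of `Q`. -/
def Separates (G : SimpleGraph V) (X Q : Set V) : Prop :=
  ∃ u ∈ Q, ∃ v ∈ Q, u ∉ X ∧ v ∉ X ∧ ¬ Linked G X u v

/-- Every component of `G - X` has all of `X` in its neighbourhood. -/
def Full (G : SimpleGraph V) (X : Set V) : Prop :=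
  ∀ u ∉ X, ∀ x ∈ X, ∃ w, Linked G X u w ∧ G.Adj w x

variable {S X Z Q R : Set V} {a u v : V}

lemma not_separates_iff :
    ¬ Separates G X Q ↔ ∀ u ∈ Q, ∀ v ∈ Q, u ∉ X → v ∉ X → Linked G X u v := by
  simp only [Separates, not_exists, not_and, not_not]

lemma Separates.mono (hQR : Q ⊆ R) (h : Separates G X Q) : Separates G X R := by
  obtain ⟨u, hu, v, hv, h⟩ := h
  exact ⟨u, hQR hu, v, hQR hv, h⟩

/-- If `X` avoids a component of `G - Z`, where `Z` is full, then the part outside `X` of the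
union of `Z` with this component is connected. -/
lemma Full.linked (hZ : Full G Z) (hX : ∀ w, Linked G Z a w → w ∉ X) (ha : a ∉ Z)
    (hu : u ∉ X) (hu' : u ∈ Z ∨ Linked G Z a u) : Linked G X a u := by
  rcases hu' with hu' | hu'
  · obtain ⟨w, hw, hwu⟩ := hZ a ha u hu'
    exact (hw.of_avoid hX).trans (.of_adj (hX w hw) hu hwu)
  · exact hu'.of_avoid hX

/-- By fullness of Z, deleting X from Z together with a component of G - Z that X misses leaves a
connected piece. All nestedness statements reduce to this. -/
lemma Full.not_separates (hZ : Full G Z) (hX : ∀ w, Linked G Z a w → w ∉ X) (ha : a ∉ Z)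
    (hQ : ∀ u ∈ Q, u ∈ Z ∨ Linked G Z a u) : ¬ Separates G X Q :=
  not_separates_iff.2 fun u hu v hv huX hvX =>
    (hZ.linked hX ha huX (hQ u hu)).symm.trans (hZ.linked hX ha hvX (hQ v hv))

/-- If X and R had vertices in different components of G - Z, then X would miss the component
containing R \ Z, and `Full.not_separates` would forbid X to separate R. -/
lemma Full.not_separates_union (hZ : Full G Z) (hX : ¬ Separates G Z X) (hR : ¬ Separates G Z R)
    (hXR : Separates G X R) : ¬ Separates G Z (X ∪ R) := by
  rw [not_separates_iff] at hX hR
  have key : ∀ u ∈ X, ∀ v ∈ R, u ∉ Z → v ∉ Z → Linked G Z u v := by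
    intro u hu v hv huZ hvZ
    by_contra huv
    refine hZ.not_separates (a := v) (fun w hw hwX => huv ?_) hvZ (fun r hr => ?_) hXR
    · exact (hX u hu w hwX huZ hw.right).trans hw.symm
    · by_cases hrZ : r ∈ Z
      exacts [.inl hrZ, .inr (hR v hv r hr hvZ hrZ)]
  rw [not_separates_iff]
  rintro u (hu | hu) v (hv | hv) huZ hvZ
  exacts [hX u hu v hv huZ hvZ, key u hu v hv huZ hvZ, (key v hv u hu hvZ huZ).symm,
    hR u hu v hv huZ hvZ]

/-- The symmetry of nestedness. -/
lemma Full.not_separates_symm (hS : Full G S) (h2 : Separates G S Set.univ)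
    (h : ¬ Separates G S X) : ¬ Separates G X S := by
  obtain ⟨u, -, v, -, hu, hv, huv⟩ := h2
  rw [not_separates_iff] at h
  -- X meets at most one component of G - S, so it misses that of u or that of v; the missed one
  -- holds S together.
  by_cases hX : ∀ w, Linked G S u w → w ∉ X
  · exact hS.not_separates hX hu fun s hs => .inl hs
  · push Not at hX
    obtain ⟨x, hx, hxX⟩ := hX
    refine hS.not_separates (a := v) (fun w hw hwX => huv ?_) hv fun s hs => .inl hs
    exact (hx.trans (h x hxX w hwX hx.right hw.right)).trans hw.symm

/-- Finitely many full sets of `n` vertices in addition to `W` separate `u` from `v`. -/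
lemma finite_full_separating_aux (u v : V) (n : ℕ) : ∀ W : Set V,
    {X | W ⊆ X ∧ (X \ W).encard = n ∧ Full G X ∧ u ∉ X ∧ v ∉ X ∧ ¬ Linked G X u v}.Finite := by
  induction n with
  | zero =>
    intro W
    refine (Set.finite_singleton W).subset ?_
    rintro X ⟨hW, hn, -⟩
    have : X \ W = ∅ := by simpa using hn
    exact (Set.sdiff_eq_empty.1 this).antisymm hW
  | succ n ih =>
    intro W
    rcases Set.eq_empty_or_nonempty
      {X | W ⊆ X ∧ (X \ W).encard = (n + 1 : ℕ) ∧ Full G X ∧ u ∉ X ∧ v ∉ X ∧ ¬ Linked G X u v}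
      with h | ⟨Y, hW, hn, hY, huY, hvY, -⟩
    · rw [h]; exact Set.finite_empty
    have hne : (Y \ W).Nonempty := by
      rw [← Set.encard_ne_zero, hn]
      simp
    obtain ⟨y, hyY, hyW⟩ := hne
    obtain ⟨w, hw, hwy⟩ := hY u huY y hyY
    obtain ⟨w', hw', hwy'⟩ := hY v hvY y hyY
    -- Fullness of a single candidate Y gives a vertex y outside W with neighbours in both
    -- components, hence a route from u to v avoiding W.
    have huv : Linked G W u v :=
      ((hw.mono hW).trans (.of_adj (fun h => hw.right (hW h)) hyW hwy)).trans
        ((hw'.mono hW).trans (.of_adj (fun h => hw'.right (hW h)) hyW hwy')).symm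
    obtain ⟨p, hp⟩ := huv
    -- Every candidate separates u from v, so it meets this one finite path; adding the vertex where
    -- it does to W lowers the count by one.
    refine (p.support.finite_toSet.biUnion fun w _ => ih (insert w W)).subset ?_
    rintro X ⟨hWX, hnX, hX, huX, hvX, huv⟩
    have : ∃ w ∈ p.support, w ∈ X := by
      by_contra! h
      exact huv ⟨p, h⟩
    obtain ⟨w, hw, hwX⟩ := this
    simp only [Set.mem_iUnion]
    refine ⟨w, hw, Set.insert_subset hwX hWX, ?_, hX, huX, hvX, huv⟩
    have h1 : X \ W = insert w (X \ insert w W) := by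
      ext x
      have := hp w hw
      simp only [Set.mem_sdiff, Set.mem_insert_iff, not_or]
      constructor
      · rintro ⟨h1, h2⟩
        by_cases hx : x = w <;> simp [*]
      · rintro (rfl | h)
        exacts [⟨hwX, this⟩, ⟨h.1, h.2.2⟩]
    rw [h1, Set.encard_insert_of_notMem (by simp)] at hnX
    push_cast at hnX
    simpa using hnX

lemma finite_full_separating (n : ℕ) (hQ : Q.Finite) :
    {X : Set V | X.encard = n ∧ Full G X ∧ Separates G X Q}.Finite := by
  refine (hQ.biUnion fun u _ => hQ.biUnion fun v _ =>
    finite_full_separating_aux (G := G) u v n ∅).subset ?_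
  rintro X ⟨hn, hX, u, hu, v, hv, h⟩
  simp only [Set.mem_iUnion]
  exact ⟨u, hu, v, hv, Set.empty_subset _, by simpa using hn, hX, h⟩

/-- The component of `v` in `G - X`. -/
def comp (G : SimpleGraph V) (X : Set V) (v : V) : Set V := {w | Linked G X v w}

lemma mem_comp : u ∈ comp G X v ↔ Linked G X v u := Iff.rfl

lemma Linked.comp_eq (h : Linked G X u v) : comp G X u = comp G X v :=
  Set.ext fun _ => ⟨h.symm.trans, h.trans⟩

/-- `K` is (the vertex set of) a component of `G - X`. -/
def IsComp (G : SimpleGraph V) (X K : Set V) : Prop := ∃ v ∉ X, K = comp G X v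

lemma isComp_comp (hv : v ∉ X) : IsComp G X (comp G X v) := ⟨v, hv, rfl⟩

lemma IsComp.eq_comp {K : Set V} (hK : IsComp G X K) (hv : v ∈ K) : K = comp G X v := by
  obtain ⟨w, hw, rfl⟩ := hK
  exact (mem_comp.1 hv).comp_eq

lemma IsComp.notMem {K : Set V} (hK : IsComp G X K) (hv : v ∈ K) : v ∉ X := by
  obtain ⟨w, hw, rfl⟩ := hK
  exact (mem_comp.1 hv).right

lemma IsComp.eq_of_mem {K L : Set V} (hK : IsComp G X K) (hL : IsComp G X L) (hvK : v ∈ K)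
    (hvL : v ∈ L) : K = L := by
  rw [hK.eq_comp hvK, hL.eq_comp hvL]

lemma comp_map {W : Type u} {H : SimpleGraph W} (φ : G ≃g H) (X : Set V) (v : V) :
    comp H (φ '' X) (φ v) = φ '' comp G X v := by
  ext w
  obtain ⟨w, rfl⟩ := φ.surjective w
  simp [comp, Linked.map_iff]

lemma IsComp.map {W : Type u} {H : SimpleGraph W} (φ : G ≃g H) {K : Set V} (hK : IsComp G X K) :
    IsComp H (φ '' X) (φ '' K) := by
  obtain ⟨v, hv, rfl⟩ := hK
  exact ⟨φ v, by simpa using hv, (comp_map φ X v).symm⟩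

lemma Separates.map {W : Type u} {H : SimpleGraph W} (φ : G ≃g H) (h : Separates G X Q) :
    Separates H (φ '' X) (φ '' Q) := by
  obtain ⟨u, hu, v, hv, h1, h2, h3⟩ := h
  exact ⟨φ u, ⟨u, hu, rfl⟩, φ v, ⟨v, hv, rfl⟩, by simpa using h1, by simpa using h2,
    by rwa [Linked.map_iff]⟩

lemma Separates.map_iff {W : Type u} {H : SimpleGraph W} (φ : G ≃g H) :
    Separates H (φ '' X) (φ '' Q) ↔ Separates G X Q := by
  refine ⟨fun h => ?_, Separates.map φ⟩
  have := h.map φ.symm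
  simpa [Set.image_image] using this

lemma Full.map {W : Type u} {H : SimpleGraph W} (φ : G ≃g H) (h : Full G X) :
    Full H (φ '' X) := by
  intro u hu x hx
  obtain ⟨u, rfl⟩ := φ.surjective u
  obtain ⟨x, hx, rfl⟩ := hx
  obtain ⟨w, hw, hwx⟩ := h u (fun h => hu ⟨u, h, rfl⟩) x hx
  exact ⟨φ w, hw.map φ, φ.map_adj_iff.2 hwx⟩

end Linked

/-! ### The two sides of an edge of a tree. -/

section EdgeCuts

variable {α : Type u} {T : SimpleGraph α} {x y : α} {p : α → Prop}

lemma iff_of_reachable_deleteEdges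
    (hp : ∀ a b, T.Adj a b → s(a, b) ≠ s(x, y) → (p a ↔ p b)) {a b : α}
    (h : (T.deleteEdges {s(x, y)}).Reachable a b) : p a ↔ p b := by
  obtain ⟨w⟩ := h
  induction w with
  | nil => rfl
  | cons h _ ih =>
    rw [SimpleGraph.deleteEdges_adj] at h
    exact (hp _ _ h.1 h.2).trans ih

lemma reachable_deleteEdges_or (hT : T.Connected) (x y a : α) :
    (T.deleteEdges {s(x, y)}).Reachable x a ∨ (T.deleteEdges {s(x, y)}).Reachable y a := by
  obtain ⟨w⟩ := hT.preconnected x a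
  suffices H : ∀ {c d : α} (w : T.Walk c d),
      (T.deleteEdges {s(x, y)}).Reachable x c ∨ (T.deleteEdges {s(x, y)}).Reachable y c →
      (T.deleteEdges {s(x, y)}).Reachable x d ∨ (T.deleteEdges {s(x, y)}).Reachable y d from
    H w (.inl .rfl)
  intro c d w
  induction w with
  | nil => exact id
  | @cons c e _ h _ ih =>
    refine fun hc => ih ?_
    by_cases he : s(c, e) = s(x, y)
    · rcases Sym2.eq_iff.1 he with ⟨-, rfl⟩ | ⟨-, rfl⟩
      exacts [.inr .rfl, .inl .rfl]
    · have : (T.deleteEdges {s(x, y)}).Adj c e := by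
        rw [SimpleGraph.deleteEdges_adj]
        exact ⟨h, he⟩
      exact hc.imp (·.trans this.reachable) (·.trans this.reachable)

/-- If `xy` is the only edge leaving the set `p`, then `p` is a side of it. -/
lemma reachable_deleteEdges_iff (hT : T.Connected)
    (hp : ∀ a b, T.Adj a b → s(a, b) ≠ s(x, y) → (p a ↔ p b)) (hx : p x) (hy : ¬ p y) (a : α) :
    (T.deleteEdges {s(x, y)}).Reachable x a ↔ p a := by
  refine ⟨fun h => (iff_of_reachable_deleteEdges hp h).1 hx, fun h => ?_⟩
  refine (reachable_deleteEdges_or hT x y a).resolve_right fun h' => hy ?_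
  exact (iff_of_reachable_deleteEdges hp h').2 h

/-- Two nodes on the same side are joined by a path that avoids the edge xy, and in a tree this is
the only path between them. -/
lemma mem_of_mem_path (hT : T.IsTree)
    (hp : ∀ a b, T.Adj a b → s(a, b) ≠ s(x, y) → (p a ↔ p b)) (hx : p x) (hy : ¬ p y)
    {a b c : α} (w : T.Walk a c) (hw : w.IsPath) (hb : b ∈ w.support) (ha : p a) (hc : p c) :
    p b := by
  classical
  have key := reachable_deleteEdges_iff hT.connected hp hx hy
  obtain ⟨q⟩ := ((key a).2 ha).symm.trans ((key c).2 hc)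
  have hle : T.deleteEdges {s(x, y)} ≤ T := SimpleGraph.deleteEdges_le _
  have hq : (q.toPath.1.mapLe hle).IsPath := q.toPath.2.mapLe hle
  have heq : w = q.toPath.1.mapLe hle := (hT.existsUnique_path a c).unique hw hq
  rw [heq, SimpleGraph.Walk.support_mapLe_eq_support] at hb
  exact (iff_of_reachable_deleteEdges hp ⟨q.toPath.1.takeUntil b hb⟩).1 ha

end EdgeCuts

/-! ### The tree-decomposition of a nested set of separators. -/

section TreeOfSeparators

variable {V : Type u} {G : SimpleGraph V} {N : Set (Set V)}

/-- A nested set of full separators of the same finite size. -/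
structure TreeLike (G : SimpleGraph V) (N : Set (Set V)) : Prop where
  exists_encard : ∃ k : ℕ, ∀ S ∈ N, S.encard = k
  full : ∀ S ∈ N, Full G S
  separates : ∀ S ∈ N, Separates G S Set.univ
  nested : ∀ S ∈ N, ∀ X ∈ N, ¬ Separates G S X

lemma TreeLike.finite (hN : TreeLike G N) {S : Set V} (hS : S ∈ N) : S.Finite := by
  obtain ⟨k, hk⟩ := hN.exists_encard
  exact Set.finite_of_encard_eq_coe (hk S hS)

lemma TreeLike.eq_of_subset (hN : TreeLike G N) {S X : Set V} (hS : S ∈ N) (hX : X ∈ N)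
    (h : S ⊆ X) : S = X := by
  obtain ⟨k, hk⟩ := hN.exists_encard
  exact (hN.finite hS).eq_of_subset_of_encard_le h (by rw [hk S hS, hk X hX])

lemma TreeLike.exists_notMem (hN : TreeLike G N) {S X : Set V} (hS : S ∈ N) (hX : X ∈ N)
    (h : S ≠ X) : ∃ v ∈ S, v ∉ X :=
  Set.not_subset.1 fun h' => h (hN.eq_of_subset hS hX h')

lemma TreeLike.finite_separating (hN : TreeLike G N) {Q : Set V} (hQ : Q.Finite) :
    {X ∈ N | Separates G X Q}.Finite := by
  obtain ⟨k, hk⟩ := hN.exists_encard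
  exact (finite_full_separating k hQ).subset fun X hX => ⟨hk X hX.1, hN.full X hX.1, hX.2⟩

/-- The vertices on the sides chosen by `b`. -/
def blockBag (N : Set (Set V)) (b : Set V → Set V) : Set V := {v | ∀ X ∈ N, v ∈ X ∪ b X}

/-- `b` chooses a component of `G - X` for every `X ∈ N`, such that all choices but one point
towards some `S ∈ N`. -/
structure IsBlock (G : SimpleGraph V) (N : Set (Set V)) (b : Set V → Set V) : Prop where
  isComp : ∀ X ∈ N, IsComp G X (b X)
  eq_empty : ∀ X ∉ N, b X = ∅
  exists_subset : N = ∅ ∨ ∃ S ∈ N, S ⊆ blockBag N b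

/-- The nodes of the tree of `N`: the elements and the blocks of `N`. -/
abbrev TreeNode (G : SimpleGraph V) (N : Set (Set V)) : Type u :=
  {S // S ∈ N} ⊕ {b // IsBlock G N b}

/-- The bag of a node. -/
def nodeBag : TreeNode G N → Set V
  | .inl S => S.1
  | .inr b => blockBag N b.1

/-- Adjacency in the tree of `N`. -/
def treeAdj : TreeNode G N → TreeNode G N → Prop
  | .inl S, .inr b => S.1 ⊆ blockBag N b.1
  | .inr b, .inl S => S.1 ⊆ blockBag N b.1
  | _, _ => False

/-- The tree of `N`: an element of `N` is adjacent to the blocks that contain it. -/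
def sepTree (G : SimpleGraph V) (N : Set (Set V)) : SimpleGraph (TreeNode G N) where
  Adj := treeAdj
  symm := ⟨by rintro (S | b) (X | c) h <;> exact h⟩
  loopless := ⟨by rintro (S | b) h <;> exact h⟩

/-- The nodes on the side of the component `K` of `G - S`. -/
def Towards (S K : Set V) : TreeNode G N → Prop
  | .inl X => X.1 ≠ S ∧ X.1 \ S ⊆ K
  | .inr b => b.1 S = K

/-- At any X ≠ S a vertex of S \ X forces the choice, so a block containing S is determined by its
choice at S. -/
lemma IsBlock.ext (hN : TreeLike G N) {b c : Set V → Set V} (hb : IsBlock G N b)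
    (hc : IsBlock G N c) {S : Set V} (hS : S ∈ N) (hSb : S ⊆ blockBag N b)
    (hSc : S ⊆ blockBag N c) (h : b S = c S) : b = c := by
  ext1 X
  by_cases hX : X ∈ N
  · by_cases hXS : S = X
    · exact hXS ▸ h
    obtain ⟨v, hvS, hvX⟩ := hN.exists_notMem hS hX hXS
    exact (hb.isComp X hX).eq_of_mem (hc.isComp X hX) ((hSb hvS X hX).resolve_left hvX)
      ((hSc hvS X hX).resolve_left hvX)
  · rw [hb.eq_empty X hX, hc.eq_empty X hX]

/-- Choose K at S and, at every other X, the component of G - X containing S \ X; nestedness makes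
it unique, and equal sizes make S \ X nonempty. -/
lemma TreeLike.exists_block (hN : TreeLike G N) {S K : Set V} (hS : S ∈ N) (hK : IsComp G S K) :
    ∃ b : {b // IsBlock G N b}, S ⊆ blockBag N b.1 ∧ b.1 S = K := by
  classical
  let b : Set V → Set V := fun X =>
    if X = S then K else {v | X ∈ N ∧ ∃ s ∈ S, Linked G X s v}
  have hbS : b S = K := if_pos rfl
  have hb : ∀ X, X ≠ S → b X = {v | X ∈ N ∧ ∃ s ∈ S, Linked G X s v} := fun X h => if_neg h
  have hsub : S ⊆ blockBag N b := by
    intro v hv X hX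
    by_cases hXS : X = S
    · exact .inl (hXS ▸ hv)
    · by_cases hvX : v ∈ X
      · exact .inl hvX
      · rw [hb X hXS]
        exact .inr ⟨hX, v, hv, .refl hvX⟩
  refine ⟨⟨b, ?_, ?_, .inr ⟨S, hS, hsub⟩⟩, hsub, hbS⟩
  · intro X hX
    by_cases hXS : X = S
    · rw [hXS, hbS]; exact hK
    · obtain ⟨v, hvS, hvX⟩ := hN.exists_notMem hS hX (Ne.symm hXS)
      refine ⟨v, hvX, ?_⟩
      rw [hb X hXS]
      ext w
      refine ⟨?_, fun h => ⟨hX, v, hvS, h⟩⟩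
      rintro ⟨-, s, hs, hsw⟩
      exact (not_separates_iff.1 (hN.nested X hX S hS) v hvS s hs hvX hsw.left).trans hsw
  · intro X hX
    rw [hb X (by rintro rfl; exact hX hS)]
    simp [hX]

/-- The edge between b and S is the only one leaving the side of b. For an adjacent pair X, c with X
≠ S, a vertex of X \ S decides both memberships; for X = S, `IsBlock.ext` leaves only c = b. -/
lemma TreeLike.towards_iff (hN : TreeLike G N) {S : {S // S ∈ N}} {b : {b // IsBlock G N b}}
    (hSb : S.1 ⊆ blockBag N b.1) (s t : TreeNode G N) (hst : (sepTree G N).Adj s t)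
    (hne : s(s, t) ≠ s(.inr b, .inl S)) :
    Towards S.1 (b.1 S.1) s ↔ Towards S.1 (b.1 S.1) t := by
  have key : ∀ (X : {S // S ∈ N}) (c : {b // IsBlock G N b}), X.1 ⊆ blockBag N c.1 →
      ¬ (c = b ∧ X = S) → (Towards S.1 (b.1 S.1) (Sum.inl X : TreeNode G N) ↔
        Towards S.1 (b.1 S.1) (Sum.inr c : TreeNode G N)) := by
    intro X c hXc hne
    by_cases hXS : X = S
    · subst hXS
      simp only [Towards, ne_eq, not_true_eq_false, false_and, false_iff]
      intro h
      exact hne ⟨Subtype.ext (c.2.ext hN b.2 X.2 hXc hSb h), rfl⟩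
    · have hXS' : X.1 ≠ S.1 := fun h => hXS (Subtype.ext h)
      obtain ⟨v, hvX, hvS⟩ := hN.exists_notMem X.2 S.2 hXS'
      simp only [Towards, ne_eq, hXS', not_false_eq_true, true_and]
      constructor
      · intro h
        exact (c.2.isComp _ S.2).eq_of_mem (b.2.isComp _ S.2)
          ((hXc hvX _ S.2).resolve_left hvS) (h ⟨hvX, hvS⟩)
      · intro h w hw
        exact h ▸ (hXc hw.1 _ S.2).resolve_left hw.2
  rcases s with X | c <;> rcases t with Y | d
  · exact hst.elim
  · exact key X d hst (by rintro ⟨rfl, rfl⟩; exact hne Sym2.eq_swap)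
  · exact (key Y c hst (by rintro ⟨rfl, rfl⟩; exact hne rfl)).symm
  · exact hst.elim

lemma not_towards_self (S K : Set V) (hS : S ∈ N) :
    ¬ Towards S K (Sum.inl ⟨S, hS⟩ : TreeNode G N) := fun h => h.1 rfl

/-- From every element of `N` one reaches a node whose bag contains a given finite set that is
not separated by `N`. -/
lemma TreeLike.exists_reachable (hN : TreeLike G N) (n : ℕ) :
    ∀ (S : {S // S ∈ N}) (Q : Set V), Q.Finite → (∀ X ∈ N, ¬ Separates G X Q) →
      {X ∈ N | Separates G X (S.1 ∪ Q)}.ncard = n →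
      ∃ t : TreeNode G N, (sepTree G N).Reachable (.inl S) t ∧ Q ⊆ nodeBag t := by
  induction n using Nat.strong_induction_on with
  | h n ih =>
  intro S Q hQ hQN hn
  by_cases hQS : Q ⊆ S.1
  · exact ⟨_, .rfl, hQS⟩
  obtain ⟨q, hqQ, hqS⟩ := Set.not_subset.1 hQS
  obtain ⟨b, hSb, hb⟩ := hN.exists_block S.2 (isComp_comp (G := G) hqS)
  by_cases hQb : Q ⊆ blockBag N b.1
  · exact ⟨.inr b, SimpleGraph.Adj.reachable
      (show (sepTree G N).Adj (.inl S) (.inr b) from hSb), hQb⟩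
  obtain ⟨r, hrQ, hr⟩ := Set.not_subset.1 hQb
  simp only [blockBag, Set.mem_ofPred_eq, not_forall, Set.mem_union, not_or] at hr
  obtain ⟨X, hX, hrX, hrb⟩ := hr
  have hXS : S.1 ≠ X := by
    rintro rfl
    rw [hb] at hrb
    exact hrb (not_separates_iff.1 (hQN _ hX) q hqQ r hrQ hqS hrX)
  -- The block b chooses at X the component containing S \ X, and r lies outside both this component
  -- and X.
  have hsep : Separates G X (S.1 ∪ Q) := by
    obtain ⟨v, hvS, hvX⟩ := hN.exists_notMem S.2 hX hXS
    refine ⟨v, .inl hvS, r, .inr hrQ, hvX, hrX, fun h => hrb ?_⟩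
    rw [(b.2.isComp X hX).eq_comp ((hSb hvS X hX).resolve_left hvX)]
    exact h
  have hsub : ∀ Z ∈ N, Separates G Z (X ∪ (S.1 ∪ Q)) → Separates G Z (S.1 ∪ Q) := by
    intro Z hZ
    contrapose!
    exact fun h => (hN.full Z hZ).not_separates_union (hN.nested Z hZ X hX) h hsep
  have hfin : {Z ∈ N | Separates G Z (S.1 ∪ Q)}.Finite :=
    hN.finite_separating ((hN.finite S.2).union hQ)
  -- The count drops strictly: whatever separates R separates S ∪ Q, whereas X separates only the
  -- latter. This allows going from S to X, with R = S ∪ X, and then on to Q, with R = X ∪ Q.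
  have hlt : ∀ R ⊆ X ∪ (S.1 ∪ Q), ¬ Separates G X R →
      {Z ∈ N | Separates G Z R}.ncard < n := by
    intro R hR hXR
    rw [← hn]
    refine Set.ncard_lt_ncard ⟨fun Z hZ => ⟨hZ.1, hsub Z hZ.1 (hZ.2.mono hR)⟩, fun h => ?_⟩ hfin
    exact hXR (h ⟨hX, hsep⟩).2
  have hunion : ∀ R, ¬ Separates G X R → ¬ Separates G X (X ∪ R) := by
    rintro R hR ⟨u, hu, v, hv, huX, hvX, h⟩
    exact hR ⟨u, hu.resolve_left huX, v, hv.resolve_left hvX, huX, hvX, h⟩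
  obtain ⟨t, ht, htX⟩ := ih _ (hlt (S.1 ∪ X) (by intro v; simp only [Set.mem_union]; tauto)
    (Set.union_comm X S.1 ▸ hunion _ (hN.nested X hX _ S.2))) S X (hN.finite hX)
    (fun Z hZ => hN.nested Z hZ X hX) rfl
  -- A node whose bag contains X is X itself, by equal sizes, or a block adjacent to X.
  have hSX : (sepTree G N).Reachable (.inl S) (.inl ⟨X, hX⟩) := by
    rcases t with Y | c
    · have : (⟨X, hX⟩ : {S // S ∈ N}) = Y := Subtype.ext (hN.eq_of_subset hX Y.2 htX)
      rwa [this]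
    · exact ht.trans (SimpleGraph.Adj.reachable
        (show (sepTree G N).Adj (.inr c) (.inl ⟨X, hX⟩) from htX))
  obtain ⟨t', ht', htQ⟩ := ih _ (hlt (X ∪ Q) (by intro v; simp only [Set.mem_union]; tauto)
    (hunion _ (hQN X hX))) ⟨X, hX⟩ Q hQ hQN rfl
  exact ⟨t', hSX.trans ht', htQ⟩

lemma TreeLike.reachable (hN : TreeLike G N) (S X : {S // S ∈ N}) :
    (sepTree G N).Reachable (.inl S) (.inl X) := by
  obtain ⟨t, ht, htX⟩ := hN.exists_reachable _ S X.1 (hN.finite X.2)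
    (fun Z hZ => hN.nested Z hZ X.1 X.2) rfl
  rcases t with Y | c
  · rwa [show X = Y from Subtype.ext (hN.eq_of_subset X.2 Y.2 htX)]
  · exact ht.trans (SimpleGraph.Adj.reachable
      (show (sepTree G N).Adj (.inr c) (.inl X) from htX))

lemma isBlock_empty : IsBlock G (∅ : Set (Set V)) (fun _ => ∅) where
  isComp := by simp
  eq_empty := by simp
  exists_subset := .inl rfl

/-- Applied to single vertices and to the ends of edges, this gives both covering axioms. -/
lemma TreeLike.exists_bag (hN : TreeLike G N) {Q : Set V} (hQ : Q.Finite)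
    (hQN : ∀ X ∈ N, ¬ Separates G X Q) : ∃ t : TreeNode G N, Q ⊆ nodeBag t := by
  rcases N.eq_empty_or_nonempty with rfl | ⟨S, hS⟩
  · exact ⟨.inr ⟨_, isBlock_empty⟩, by simp [nodeBag, blockBag]⟩
  · obtain ⟨t, -, ht⟩ := hN.exists_reachable _ ⟨S, hS⟩ Q hQ hQN rfl
    exact ⟨t, ht⟩

lemma TreeLike.connected (hN : TreeLike G N) : (sepTree G N).Connected := by
  have : Nonempty (TreeNode G N) := by
    obtain ⟨t, -⟩ := hN.exists_bag Set.finite_empty fun X _ => by simp [Separates]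
    exact ⟨t⟩
  refine ⟨?_⟩
  rcases N.eq_empty_or_nonempty with rfl | ⟨S, hS⟩
  · have : ∀ t : TreeNode G (∅ : Set (Set V)), t = .inr ⟨_, isBlock_empty⟩ := by
      rintro (S | b)
      · exact S.2.elim
      · congr 1
        ext1
        funext X
        exact b.2.eq_empty X (by simp)
    intro s t
    rw [this s, this t]
  · have : ∀ t : TreeNode G N, (sepTree G N).Reachable (.inl ⟨S, hS⟩) t := by
      rintro (X | b)
      · exact hN.reachable _ _
      · obtain ⟨X, hX, hXb⟩ := b.2.exists_subset.resolve_left (Set.nonempty_iff_ne_empty.1 ⟨S, hS⟩)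
        exact (hN.reachable ⟨S, hS⟩ ⟨X, hX⟩).trans (SimpleGraph.Adj.reachable
          (show (sepTree G N).Adj (.inl ⟨X, hX⟩) (.inr b) from hXb))
    exact fun s t => (this s).symm.trans (this t)

lemma TreeLike.isTree (hN : TreeLike G N) : (sepTree G N).IsTree := by
  refine ⟨hN.connected, SimpleGraph.isAcyclic_iff_forall_adj_isBridge.2 ?_⟩
  have key : ∀ (S : {S // S ∈ N}) (b : {b // IsBlock G N b}), S.1 ⊆ blockBag N b.1 →
      (sepTree G N).IsBridge s(.inr b, .inl S) := by
    intro S b h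
    rw [SimpleGraph.isBridge_iff]
    intro hr
    exact not_towards_self S.1 (b.1 S.1) S.2
      ((iff_of_reachable_deleteEdges (hN.towards_iff h) hr).1 rfl)
  rintro (S | b) (X | c) h
  · exact h.elim
  · rw [Sym2.eq_swap]; exact key S c h
  · exact key X b h
  · exact h.elim

lemma TreeLike.towards_of_mem (hN : TreeLike G N) {S K : Set V} (hS : S ∈ N) (hK : IsComp G S K)
    {v : V} (hv : v ∈ K) {t : TreeNode G N} (ht : v ∈ nodeBag t) : Towards S K t := by
  have hvS := hK.notMem hv
  rcases t with X | b
  · refine ⟨fun h => hvS (h ▸ ht), fun w hw => ?_⟩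
    rw [hK.eq_comp hv]
    exact not_separates_iff.1 (hN.nested S hS X.1 X.2) v ht w hw.1 hvS hw.2
  · exact (b.2.isComp S hS).eq_of_mem hK ((ht S hS).resolve_left hvS) hv

lemma nodeBag_subset {S K : Set V} (hS : S ∈ N)
    {t : TreeNode G N} (ht : Towards S K t) : nodeBag t ⊆ S ∪ K := by
  intro v hv
  by_cases hvS : v ∈ S
  · exact .inl hvS
  right
  rcases t with X | b
  · exact ht.2 ⟨hv, hvS⟩
  · exact ht ▸ (hv S hS).resolve_left hvS

/-- A vertex missing from a bag is cut off from it by some element of N; for a node X in N, the set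
X itself serves. -/
lemma exists_not_towards {v : V} {t : TreeNode G N} (hv : v ∉ nodeBag t) :
    ∃ S ∈ N, v ∉ S ∧ ¬ Towards S (comp G S v) t := by
  rcases t with X | b
  · exact ⟨X.1, X.2, hv, not_towards_self _ _ X.2⟩
  · simp only [nodeBag, blockBag, Set.mem_ofPred_eq, not_forall, Set.mem_union, not_or] at hv
    obtain ⟨S, hS, hvS, hvb⟩ := hv
    refine ⟨S, hS, hvS, fun h => hvb ?_⟩
    rw [show b.1 S = comp G S v from h]
    exact .refl hvS

/-- The tree-decomposition defined by a nested set of separators. -/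
def treeDecomposition (hN : TreeLike G N) : TreeDecomposition G where
  node := TreeNode G N
  tree := sepTree G N
  isTree := hN.isTree
  bag := nodeBag
  cover_vertex v := by
    obtain ⟨t, ht⟩ := hN.exists_bag (Set.finite_singleton v) fun X _ => by
      rintro ⟨u, rfl, w, rfl, h, -, h'⟩
      exact h' (.refl h)
    exact ⟨t, ht rfl⟩
  cover_edge v w hvw := by
    obtain ⟨t, ht⟩ := hN.exists_bag (Q := {v, w}) (by simp) fun X _ => by
      rintro ⟨x, rfl | rfl, y, rfl | rfl, h, h', h''⟩
      exacts [h'' (.refl h), h'' (.of_adj h h' hvw), h'' (.of_adj h h' hvw.symm), h'' (.refl h)]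
    exact ⟨t, ht (by simp), ht (by simp)⟩
  path_inter t₁ t₂ t₃ p hp ht := by
    rintro v ⟨h₁, h₃⟩
    by_contra h₂
    -- Both end nodes lie on the side of S containing v and t₂ does not, although sides are closed
    -- under paths.
    obtain ⟨S, hS, hvS, h⟩ := exists_not_towards h₂
    have hK : IsComp G S (comp G S v) := isComp_comp hvS
    have hv : v ∈ comp G S v := .refl hvS
    obtain ⟨b, hSb, hb⟩ := hN.exists_block hS hK
    have hp' := hN.towards_iff (S := ⟨S, hS⟩) hSb
    rw [← hb] at h hv hK
    exact h (mem_of_mem_path hN.isTree hp' rfl (not_towards_self _ _ hS) p hp ht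
      (hN.towards_of_mem hS hK hv h₁) (hN.towards_of_mem hS hK hv h₃))

lemma treeDecomposition_side (hN : TreeLike G N) {S : {S // S ∈ N}} {b : {b // IsBlock G N b}}
    (h : S.1 ⊆ blockBag N b.1) :
    (treeDecomposition hN).side (.inr b : TreeNode G N) (.inl S : TreeNode G N)
      = S.1 ∪ b.1 S.1 := by
  have key := reachable_deleteEdges_iff hN.connected (hN.towards_iff h) rfl
    (not_towards_self _ _ S.2)
  ext v
  simp only [TreeDecomposition.side, Set.mem_iUnion, Set.mem_ofPred_eq, exists_prop]
  constructor
  · rintro ⟨t, ht, hv⟩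
    exact nodeBag_subset S.2 ((key t).1 ht) hv
  · rintro (hv | hv)
    · exact ⟨.inr b, .rfl, h hv⟩
    · obtain ⟨t, ht⟩ := (treeDecomposition hN).cover_vertex v
      exact ⟨t, (key t).2 (hN.towards_of_mem S.2 (b.2.isComp _ S.2) hv ht), ht⟩

lemma treeDecomposition_side_symm (hN : TreeLike G N) {S : {S // S ∈ N}}
    {b : {b // IsBlock G N b}} (h : S.1 ⊆ blockBag N b.1) :
    (treeDecomposition hN).side (.inl S : TreeNode G N) (.inr b : TreeNode G N)
      = (b.1 S.1)ᶜ := by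
  have hp : ∀ s t : TreeNode G N, (sepTree G N).Adj s t → s(s, t) ≠ s(.inl S, .inr b) →
      (¬ Towards S.1 (b.1 S.1) s ↔ ¬ Towards S.1 (b.1 S.1) t) := fun s t hst hne =>
    not_congr (hN.towards_iff h s t hst (by rwa [Sym2.eq_swap (a := Sum.inr b)]))
  have key := reachable_deleteEdges_iff hN.connected hp (not_towards_self _ _ S.2)
    (not_not.2 rfl)
  ext v
  simp only [TreeDecomposition.side, Set.mem_iUnion, Set.mem_ofPred_eq, exists_prop,
    Set.mem_compl_iff]
  have hK := b.2.isComp _ S.2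
  constructor
  · rintro ⟨t, ht, hv⟩ hvK
    exact (key t).1 ht (hN.towards_of_mem S.2 hK hvK hv)
  · intro hv
    by_cases hvS : v ∈ S.1
    · exact ⟨.inl S, .rfl, hvS⟩
    · obtain ⟨t, ht⟩ := (treeDecomposition hN).cover_vertex v
      refine ⟨t, (key t).2 fun ht' => ?_, ht⟩
      exact (nodeBag_subset S.2 ht' ht).elim hvS hv

lemma treeDecomposition_isBalanced (hN : TreeLike G N) {k : ℕ} (hk : ∀ S ∈ N, S.encard = k) :
    (treeDecomposition hN).IsBalanced k := by
  rintro (S | b) (X | c) h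
  · exact h.elim
  · show (S.1 ∩ blockBag N c.1).encard = k
    rw [Set.inter_eq_left.2 h, hk _ S.2]
  · show (blockBag N b.1 ∩ X.1).encard = k
    rw [Set.inter_eq_right.2 h, hk _ X.2]
  · exact h.elim

end TreeOfSeparators

/-! ### Action of graph isomorphisms on the trees. -/

section TreeIso

variable {V W : Type u} {G : SimpleGraph V} {H : SimpleGraph W} {N : Set (Set V)}
  {N' : Set (Set W)}

lemma image_preimage_iso (φ : G ≃g H) (Y : Set W) : φ '' (φ ⁻¹' Y) = Y :=
  Set.image_preimage_eq Y φ.surjective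

lemma preimage_image_iso (φ : G ≃g H) (X : Set V) : φ ⁻¹' (φ '' X) = X :=
  Set.preimage_image_eq X φ.injective

lemma forall_mem_image_iff (φ : G ≃g H) (hN : ∀ S, S ∈ N ↔ φ '' S ∈ N') {p : Set W → Prop} :
    (∀ Y ∈ N', p Y) ↔ ∀ X ∈ N, p (φ '' X) := by
  refine ⟨fun h X hX => h _ ((hN X).1 hX), fun h Y hY => ?_⟩
  rw [← image_preimage_iso φ Y] at hY ⊢
  exact h _ ((hN _).2 hY)

lemma mem_iff_symm_image_mem (φ : G ≃g H) (hN : ∀ S, S ∈ N ↔ φ '' S ∈ N') (Y : Set W) :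
    Y ∈ N' ↔ φ.symm '' Y ∈ N := by
  rw [hN, Set.image_image]
  simp

/-- The image of a choice of components under a graph isomorphism. -/
def blockMap (φ : G ≃g H) (b : Set V → Set V) : Set W → Set W := fun Y => φ '' b (φ ⁻¹' Y)

lemma blockMap_image (φ : G ≃g H) (b : Set V → Set V) (X : Set V) :
    blockMap φ b (φ '' X) = φ '' b X := by
  rw [blockMap, preimage_image_iso]

lemma blockBag_blockMap (φ : G ≃g H) (hN : ∀ S, S ∈ N ↔ φ '' S ∈ N') (b : Set V → Set V) :
    blockBag N' (blockMap φ b) = φ '' blockBag N b := by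
  ext w
  obtain ⟨v, rfl⟩ := φ.surjective w
  rw [φ.injective.mem_set_image]
  simp only [blockBag, Set.mem_ofPred_eq]
  rw [forall_mem_image_iff φ hN]
  simp only [blockMap_image, Set.mem_union, φ.injective.mem_set_image]

lemma IsBlock.map (φ : G ≃g H) (hN : ∀ S, S ∈ N ↔ φ '' S ∈ N') {b : Set V → Set V}
    (hb : IsBlock G N b) : IsBlock H N' (blockMap φ b) where
  isComp := (forall_mem_image_iff φ hN).2 fun X hX => by
    rw [blockMap_image]
    exact (hb.isComp X hX).map φ
  eq_empty Y hY := by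
    rw [blockMap, hb.eq_empty _ fun h => hY ?_, Set.image_empty]
    rw [hN, image_preimage_iso] at h
    exact h
  exists_subset := by
    rcases hb.exists_subset with rfl | ⟨S, hS, h⟩
    · left
      rw [Set.eq_empty_iff_forall_notMem]
      exact (forall_mem_image_iff φ hN (p := fun _ => False)).2 (by simp)
    · exact .inr ⟨_, (hN S).1 hS, by rw [blockBag_blockMap φ hN]; exact Set.image_mono h⟩

/-- The action of a graph isomorphism on the nodes. -/
def nodeMap (φ : G ≃g H) (hN : ∀ S, S ∈ N ↔ φ '' S ∈ N') : TreeNode G N → TreeNode H N' :=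
  Sum.map (fun S => ⟨φ '' S.1, (hN _).1 S.2⟩) (fun b => ⟨blockMap φ b.1, b.2.map φ hN⟩)

lemma nodeMap_eq_self (φ : G ≃g G) (hφ : ∀ v, φ v = v) (hN : ∀ S, S ∈ N ↔ φ '' S ∈ N)
    (t : TreeNode G N) : nodeMap φ hN t = t := by
  have h : (φ : V → V) = id := funext hφ
  rcases t with S | b
  · exact congrArg Sum.inl (Subtype.ext (by simp [h]))
  · exact congrArg Sum.inr (Subtype.ext (by funext X; simp [blockMap, h]))

/-- The composite ω is a separate map that agrees pointwise with χ ∘ φ, so that the same lemma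
yields the inverse laws and functoriality. -/
lemma nodeMap_nodeMap {U : Type u} {I : SimpleGraph U} {N'' : Set (Set U)} (φ : G ≃g H)
    (χ : H ≃g I) (ω : G ≃g I) (hω : ∀ v, ω v = χ (φ v)) (hN : ∀ S, S ∈ N ↔ φ '' S ∈ N')
    (hN' : ∀ S, S ∈ N' ↔ χ '' S ∈ N'') (hN'' : ∀ S, S ∈ N ↔ ω '' S ∈ N'') (t : TreeNode G N) :
    nodeMap χ hN' (nodeMap φ hN t) = nodeMap ω hN'' t := by
  have h : (ω : V → U) = χ ∘ φ := funext hω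
  rcases t with S | b
  · exact congrArg Sum.inl (Subtype.ext (by simp [h, Set.image_image]))
  · exact congrArg Sum.inr (Subtype.ext (by
      funext X
      simp [blockMap, h, Set.image_image, Set.preimage_comp]))

lemma nodeBag_nodeMap (φ : G ≃g H) (hN : ∀ S, S ∈ N ↔ φ '' S ∈ N') (t : TreeNode G N) :
    nodeBag (nodeMap φ hN t) = φ '' nodeBag t := by
  rcases t with S | b
  · rfl
  · exact blockBag_blockMap φ hN b.1

lemma treeAdj_nodeMap (φ : G ≃g H) (hN : ∀ S, S ∈ N ↔ φ '' S ∈ N') (s t : TreeNode G N) :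
    treeAdj (nodeMap φ hN s) (nodeMap φ hN t) ↔ treeAdj s t := by
  rcases s with S | b <;> rcases t with X | c
  · rfl
  · simp [nodeMap, treeAdj, blockBag_blockMap φ hN, Set.image_subset_image_iff φ.injective]
  · simp [nodeMap, treeAdj, blockBag_blockMap φ hN, Set.image_subset_image_iff φ.injective]
  · rfl

/-- The action of a graph isomorphism on the trees. -/
def sepTreeIso (φ : G ≃g H) (hN : ∀ S, S ∈ N ↔ φ '' S ∈ N') : sepTree G N ≃g sepTree H N' where
  toFun := nodeMap φ hN
  invFun := nodeMap φ.symm (mem_iff_symm_image_mem φ hN)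
  left_inv t := by
    rw [nodeMap_nodeMap φ φ.symm (RelIso.refl _) (by simp) hN _ (by simp)]
    exact nodeMap_eq_self _ (fun _ => rfl) _ t
  right_inv t := by
    rw [nodeMap_nodeMap φ.symm φ (RelIso.refl _) (by simp) _ _ (by simp)]
    exact nodeMap_eq_self _ (fun _ => rfl) _ t
  map_rel_iff' := treeAdj_nodeMap φ hN _ _

lemma TreeLike.map (φ : G ≃g H) (hN : ∀ S, S ∈ N ↔ φ '' S ∈ N') (h : TreeLike G N) :
    TreeLike H N' where
  exists_encard := by
    obtain ⟨k, hk⟩ := h.exists_encard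
    refine ⟨k, (forall_mem_image_iff φ hN).2 fun S hS => ?_⟩
    rw [φ.injective.encard_image, hk S hS]
  full := (forall_mem_image_iff φ hN).2 fun S hS => (h.full S hS).map φ
  separates := (forall_mem_image_iff φ hN).2 fun S hS =>
    ((h.separates S hS).map φ).mono (Set.subset_univ _)
  nested := (forall_mem_image_iff φ hN).2 fun S hS => (forall_mem_image_iff φ hN).2 fun X hX => by
    rw [Separates.map_iff]
    exact h.nested S hS X hX

end TreeIso

/-! ### Relevant separators of profiles and their uncrossing. -/

section Profiles

variable {V : Type u} {G : SimpleGraph V} {Ps : Set (Set (Separation G))}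
  {P P' Q Q' : Set (Separation G)} {s t : Separation G} {S X : Set V} {k : ℕ}

namespace Separation

lemma separator_flip (s : Separation G) : s.flip.separator = s.separator :=
  Set.inter_comm _ _

lemma order_flip (s : Separation G) : s.flip.order = s.order := by
  rw [order, order, separator_flip]

lemma mem_or (s : Separation G) (v : V) : v ∈ s.left ∨ v ∈ s.right := by
  have : v ∈ s.left ∪ s.right := s.cover ▸ Set.mem_univ v
  exact this

lemma mem_left_sdiff_right_of_linked (s : Separation G) {u v : V}
    (h : Linked G s.separator u v) (hu : u ∈ s.left \ s.right) : v ∈ s.left \ s.right := by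
  obtain ⟨p, hp⟩ := h
  induction p with
  | nil => exact hu
  | @cons a b c hab q ih =>
    refine ih ?_ fun x hx => hp x (by simp [hx])
    have hb : b ∉ s.separator := hp b (by simp)
    by_contra hb'
    refine s.no_edge a hu b ?_ hab
    have := s.mem_or b
    simp only [separator, Set.mem_inter_iff, Set.mem_sdiff] at *
    tauto

lemma mem_right_sdiff_left_of_linked (s : Separation G) {u v : V}
    (h : Linked G s.separator u v) (hu : u ∈ s.right \ s.left) : v ∈ s.right \ s.left :=
  s.flip.mem_left_sdiff_right_of_linked (s.separator_flip ▸ h) hu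

lemma subset_or_of_not_separates (s : Separation G) (h : ¬ Separates G s.separator X) :
    X ⊆ s.left ∨ X ⊆ s.right := by
  by_contra! h'
  obtain ⟨h1, h2⟩ := h'
  obtain ⟨u, hu, hus⟩ := Set.not_subset.1 h1
  obtain ⟨v, hv, hvs⟩ := Set.not_subset.1 h2
  have := s.mem_right_sdiff_left_of_linked
    (not_separates_iff.1 h u hu v hv (fun h => hus h.1) (fun h => hvs h.2))
    ⟨(s.mem_or u).resolve_left hus, hus⟩
  exact hvs this.1

lemma separates_univ (s : Separation G) (hl : (s.left \ s.right).Nonempty)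
    (hr : (s.right \ s.left).Nonempty) : Separates G s.separator Set.univ := by
  obtain ⟨u, hu⟩ := hl
  obtain ⟨v, hv⟩ := hr
  exact ⟨u, trivial, v, trivial, fun h => hu.2 h.2, fun h => hv.2 h.1,
    fun h => hv.2 (s.mem_left_sdiff_right_of_linked h hu).1⟩

lemma separator_corner_subset (s t : Separation G) :
    (s.corner t).separator ⊆ s.separator ∪ t.separator := by
  intro v
  simp only [separator, corner, Set.mem_inter_iff, Set.mem_union]
  tauto

/-- Submodularity: the union and the intersection of the corner separators lie in the union and the
intersection of the original ones. -/
lemma order_corner_add_order_corner_le (s t : Separation G) :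
    (s.flip.corner t.flip).order + (s.corner t).order ≤ s.order + t.order := by
  simp only [order]
  rw [← Set.encard_union_add_encard_inter, ← Set.encard_union_add_encard_inter s.separator]
  refine add_le_add (Set.encard_le_encard (Set.union_subset ?_ ?_)) (Set.encard_le_encard ?_)
  · have := separator_corner_subset s.flip t.flip
    rwa [separator_flip, separator_flip] at this
  · exact separator_corner_subset s t
  · intro v
    simp only [separator, corner, flip, Set.mem_inter_iff, Set.mem_union]
    tauto

/-- If `X` lies on one side of `s` or of `t`, then it does not separate the separator of a corner
on the other side. -/
lemma not_separates_corner (s t : Separation G) (hc : Full G (s.corner t).separator)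
    (hne : ((s.corner t).left \ (s.corner t).right).Nonempty)
    (hX : X ⊆ s.right ∨ X ⊆ t.right) : ¬ Separates G X (s.corner t).separator := by
  obtain ⟨a, ha⟩ := hne
  refine hc.not_separates (a := a) (fun w hw hwX => ?_) (fun h => ha.2 h.2) fun u hu => .inl hu
  refine ((s.corner t).mem_left_sdiff_right_of_linked hw ha).2 ?_
  exact hX.imp (fun h => h hwX) (fun h => h hwX)

end Separation

open Separation

lemma IsPrincipal.nonempty (hP : IsPrincipal P) (hs : s ∈ P) : (s.right \ s.left).Nonempty := by
  simpa using hP {s} (by simpa using hs) (by simp)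

lemma Separation.Distinguishes.symm (h : s.Distinguishes P Q) : s.Distinguishes Q P :=
  Or.symm (h.imp And.symm And.symm)

lemma Separation.Distinguishes.flip (h : s.Distinguishes P Q) : s.flip.Distinguishes P Q :=
  Or.symm h

lemma kappa_le_order (hP : P ∈ Ps) (hQ : Q ∈ Ps) (h : s.Distinguishes P Q) :
    kappa Ps ≤ s.order :=
  sInf_le ⟨s, rfl, P, hP, Q, hQ, h⟩

lemma linked_of_mem_supp {u w : V} (hu : u ∉ S)
    (hw : w ∈ (G.componentComplMk hu).supp) : Linked G S u w := by
  obtain ⟨hwS, h⟩ := hw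
  obtain ⟨p⟩ := SimpleGraph.ConnectedComponent.exact h.symm
  refine ⟨p.map (SimpleGraph.Embedding.induce Sᶜ).toHom, fun x hx => ?_⟩
  obtain ⟨y, -, rfl⟩ := List.mem_map.1
    ((SimpleGraph.Walk.support_map (SimpleGraph.Embedding.induce Sᶜ).toHom p) ▸ hx)
  exact y.2

/-- A vertex of the separator without a neighbour in a component C would make N(C) a proper subset,
so that (C ∪ N(C), V \ C) would be a degenerator. -/
lemma WellSeparable.full (hG : WellSeparable Ps) (hP : P ∈ Ps) (hQ : Q ∈ Ps)
    (h : s.Distinguishes P Q) (hs : s.order ≤ kappa Ps) (hs' : s.order < ⊤) :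
    Full G s.separator := by
  intro u hu x hx
  let C := G.componentComplMk hu
  have hsub : nbhd G C.supp ⊆ s.separator := by
    rintro v ⟨hv, w, hw, hwv⟩
    by_contra hvS
    exact hv (SimpleGraph.ComponentCompl.mem_of_adj w v hw hvS hwv)
  have hx' : x ∈ nbhd G C.supp := by
    by_contra hx'
    let d : Separation G :=
      { left := C.supp ∪ nbhd G C.supp
        right := C.suppᶜ
        cover := by ext v; simp only [Set.mem_union, Set.mem_compl_iff, Set.mem_univ,
          iff_true]; tauto
        no_edge := by
          rintro a ⟨-, ha⟩ b ⟨hb, hb'⟩ hab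
          exact hb' (.inr ⟨hb, a, Set.notMem_compl_iff.1 ha, hab⟩) }
    have : d ∈ degenerator (kappa Ps) Ps :=
      ⟨s, ⟨hs, hs', P, hP, Q, hQ, h⟩, C, ⟨hsub, fun h => hx' (h hx)⟩, rfl, rfl⟩
    rw [hG] at this
    exact this
  obtain ⟨-, w, hw, hwx⟩ := hx'
  exact ⟨w, linked_of_mem_supp hu hw, hwx⟩

/-- The separators of the separations of order `κ(Ps, G)` that distinguish `P` and `Q`. -/
def sepsOf (Ps : Set (Set (Separation G))) (P Q : Set (Separation G)) : Set (Set V) :=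
  {S | ∃ s : Separation G, s.separator = S ∧ s.order ≤ kappa Ps ∧ s.order < ⊤ ∧
    s.Distinguishes P Q}

/-- The separators of the separations of order `κ(Ps, G)` that distinguish two members
of `Ps`. -/
def allSeps (Ps : Set (Set (Separation G))) : Set (Set V) :=
  {S | ∃ P ∈ Ps, ∃ Q ∈ Ps, S ∈ sepsOf Ps P Q}

/-- The relevant separators that cross `S`. -/
def crossings (Ps : Set (Set (Separation G))) (S : Set V) : Set (Set V) :=
  {X ∈ allSeps Ps | Separates G X S}

/-- The elements of `sepsOf Ps P Q` with the least number of crossings, for `P, Q ∈ Ps`. -/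
def optSeps (Ps : Set (Set (Separation G))) : Set (Set V) :=
  {S | ∃ P ∈ Ps, ∃ Q ∈ Ps, S ∈ sepsOf Ps P Q ∧
    ∀ X ∈ sepsOf Ps P Q, (crossings Ps S).ncard ≤ (crossings Ps X).ncard}

lemma sepsOf_comm (Ps : Set (Set (Separation G))) (P Q : Set (Separation G)) :
    sepsOf Ps P Q = sepsOf Ps Q P := by
  ext S
  constructor <;> exact fun ⟨s, h1, h2, h3, h4⟩ => ⟨s, h1, h2, h3, h4.symm⟩

lemma le_of_add_le_two_mul {m n : ℕ∞} (hm : k ≤ m) (hn : k ≤ n) (h : m + n ≤ k + k) :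
    m ≤ k ∧ n ≤ k := by
  have h1 : m ≠ ⊤ := by
    rintro rfl
    rw [top_add, top_le_iff] at h
    exact ENat.natCast_ne_top (k + k) (by exact_mod_cast h)
  have h2 : n ≠ ⊤ := by
    rintro rfl
    rw [add_top, top_le_iff] at h
    exact ENat.natCast_ne_top (k + k) (by exact_mod_cast h)
  lift m to ℕ using h1
  lift n to ℕ using h2
  norm_cast at *
  omega

/-- The assumptions on `Ps`, without robustness, which is not needed. -/
structure Admissible (Ps : Set (Set (Separation G))) (k : ℕ) : Prop where
  kappa_eq : kappa Ps = k
  isKProfile : ∀ P ∈ Ps, IsKProfile (k + 1) P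
  isPrincipal : ∀ P ∈ Ps, IsPrincipal P
  wellSeparable : WellSeparable Ps

namespace Admissible

lemma mem_or (h : Admissible Ps k) (hP : P ∈ Ps) (hs : s.order ≤ k) : s ∈ P ∨ s.flip ∈ P :=
  (h.isKProfile P hP).2.2 s (hs.trans_lt (by exact_mod_cast Nat.lt_succ_self k))

lemma order_le (h : Admissible Ps k) (hP : P ∈ Ps) (hs : s ∈ P) : s.order ≤ k := by
  have := (h.isKProfile P hP).2.1 s hs
  push_cast at this
  exact Order.lt_add_one_iff_of_not_isMax (by simp) |>.1 this

lemma mem_sepsOf (h : Admissible Ps k) (hs : s.order ≤ k) (hd : s.Distinguishes P Q) :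
    s.separator ∈ sepsOf Ps P Q :=
  ⟨s, rfl, h.kappa_eq ▸ hs, hs.trans_lt (by simp), hd⟩

lemma full (h : Admissible Ps k) (hS : S ∈ allSeps Ps) : Full G S := by
  obtain ⟨P, hP, Q, hQ, s, rfl, h1, h2, h3⟩ := hS
  exact h.wellSeparable.full hP hQ h3 h1 h2

lemma encard (h : Admissible Ps k) (hS : S ∈ allSeps Ps) : S.encard = k := by
  obtain ⟨P, hP, Q, hQ, s, rfl, h1, h2, h3⟩ := hS
  rw [← h.kappa_eq]
  exact h1.antisymm (kappa_le_order hP hQ h3)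

lemma nonempty (h : Admissible Ps k) (hP : P ∈ Ps) (hQ : Q ∈ Ps) (hd : s.Distinguishes P Q) :
    (s.left \ s.right).Nonempty ∧ (s.right \ s.left).Nonempty := by
  rcases hd with ⟨h1, h2⟩ | ⟨h1, h2⟩
  · exact ⟨(h.isPrincipal Q hQ).nonempty h2, (h.isPrincipal P hP).nonempty h1⟩
  · exact ⟨(h.isPrincipal P hP).nonempty h1, (h.isPrincipal Q hQ).nonempty h2⟩

lemma separates_univ (h : Admissible Ps k) (hS : S ∈ allSeps Ps) :
    Separates G S Set.univ := by
  obtain ⟨P, hP, Q, hQ, s, rfl, h1, h2, h3⟩ := hS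
  exact s.separates_univ (h.nonempty hP hQ h3).1 (h.nonempty hP hQ h3).2

lemma not_separates_symm (h : Admissible Ps k) (hS : S ∈ allSeps Ps)
    (hSX : ¬ Separates G S X) : ¬ Separates G X S :=
  (h.full hS).not_separates_symm (h.separates_univ hS) hSX

lemma finite_crossings (h : Admissible Ps k) (hS : S ∈ allSeps Ps) : (crossings Ps S).Finite :=
  (finite_full_separating k (Set.finite_of_encard_eq_coe (h.encard hS))).subset
    fun _ hX => ⟨h.encard hX.1, h.full hX.1, hX.2⟩

/-- (P2) decides the orientation of the corner in P. In P' consistency does, as the corner lies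
below `s.flip` and below `t.flip`. -/
lemma corner_distinguishes (h : Admissible Ps k) (hP : P ∈ Ps) (hP' : P' ∈ Ps) (hs : s ∈ P)
    (ht : t ∈ P) (hst : s.flip ∈ P' ∨ t.flip ∈ P') (hc : (s.flip.corner t.flip).order ≤ k) :
    (s.flip.corner t.flip).Distinguishes P P' := by
  have h1 : (s.flip.corner t.flip).flip ∈ P :=
    (h.mem_or hP hc).resolve_left ((h.isKProfile P hP).1.2 s hs t ht)
  refine .inr ⟨h1, (h.mem_or hP' hc).resolve_right ?_⟩
  rcases hst with hst | hst
  · exact (h.isKProfile P' hP').1.1 _ _ ⟨Set.inter_subset_left, Set.subset_union_left⟩ hst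
  · exact (h.isKProfile P' hP').1.1 _ _ ⟨Set.inter_subset_right, Set.subset_union_right⟩ hst

lemma le_order_corner (h : Admissible Ps k) (hP : P ∈ Ps) (hP' : P' ∈ Ps) (hs : s ∈ P)
    (ht : t ∈ P) (hst : s.flip ∈ P' ∨ t.flip ∈ P') : k ≤ (s.flip.corner t.flip).order := by
  by_contra! hc
  have := kappa_le_order hP hP' (h.corner_distinguishes hP hP' hs ht hst hc.le)
  rw [h.kappa_eq] at this
  exact this.not_gt hc

/-- Uncrossing: opposite corners of two crossing separations have together fewer crossings. -/
lemma ncard_crossings_corner_lt (h : Admissible Ps k) (hsA : s.separator ∈ allSeps Ps)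
    (htA : t.separator ∈ allSeps Ps) (hcA : (s.flip.corner t.flip).separator ∈ allSeps Ps)
    (hdA : (s.corner t).separator ∈ allSeps Ps)
    (hcne : ((s.flip.corner t.flip).left \ (s.flip.corner t.flip).right).Nonempty)
    (hdne : ((s.corner t).left \ (s.corner t).right).Nonempty)
    (hcross : Separates G t.separator s.separator) :
    (crossings Ps (s.flip.corner t.flip).separator).ncard +
        (crossings Ps (s.corner t).separator).ncard <
      (crossings Ps s.separator).ncard + (crossings Ps t.separator).ncard := by
  have hcX : ∀ X, X ⊆ s.left ∨ X ⊆ t.left →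
      ¬ Separates G X (s.flip.corner t.flip).separator := fun X hX =>
    s.flip.not_separates_corner t.flip (h.full hcA) hcne hX
  have hdX : ∀ X, X ⊆ s.right ∨ X ⊆ t.right → ¬ Separates G X (s.corner t).separator :=
    fun X hX => s.not_separates_corner t (h.full hdA) hdne hX
  have hcsub : (s.flip.corner t.flip).separator ⊆ s.separator ∪ t.separator := by
    have := separator_corner_subset s.flip t.flip
    rwa [separator_flip, separator_flip] at this
  have hdsub := separator_corner_subset s t
  generalize (s.flip.corner t.flip).separator = C at *
  generalize (s.corner t).separator = D at *
  have hunion : ∀ X ∈ allSeps Ps, Separates G X (s.separator ∪ t.separator) →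
      X ∈ crossings Ps s.separator ∪ crossings Ps t.separator := by
    intro X hX hXst
    by_contra hX'
    simp only [crossings, Set.mem_union, Set.mem_ofPred_eq, not_or, not_and] at hX'
    rw [Set.union_comm] at hXst
    exact (h.full hX).not_separates_union (hX'.2 hX) (hX'.1 hX) hcross hXst
  -- Corner separators lie in the union of the two originals, so what crosses a corner crosses s or
  -- t. The strict gain is the separator of t: it crosses s, but lies in both sides of t and so
  -- crosses neither corner.
  have h1 : crossings Ps C ∪ crossings Ps D ⊆
      (crossings Ps s.separator ∪ crossings Ps t.separator) \ {t.separator} := by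
    rintro X (hX | hX)
    · refine ⟨hunion X hX.1 (hX.2.mono hcsub), ?_⟩
      rintro rfl
      exact hcX _ (.inr Set.inter_subset_left) hX.2
    · refine ⟨hunion X hX.1 (hX.2.mono hdsub), ?_⟩
      rintro rfl
      exact hdX _ (.inr Set.inter_subset_right) hX.2
  -- If X were nested with s or with t, it would lie on one side of it and could not cross the
  -- corner on the other side.
  have h2 : crossings Ps C ∩ crossings Ps D ⊆
      crossings Ps s.separator ∩ crossings Ps t.separator := by
    rintro X ⟨hX, hX'⟩
    refine ⟨⟨hX.1, ?_⟩, ⟨hX.1, ?_⟩⟩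
    · by_contra hXs
      rcases s.subset_or_of_not_separates (h.not_separates_symm hX.1 hXs) with h' | h'
      exacts [hcX X (.inl h') hX.2, hdX X (.inl h') hX'.2]
    · by_contra hXt
      rcases t.subset_or_of_not_separates (h.not_separates_symm hX.1 hXt) with h' | h'
      exacts [hcX X (.inr h') hX.2, hdX X (.inr h') hX'.2]
  have hfs := h.finite_crossings hsA
  have hft := h.finite_crossings htA
  rw [← Set.ncard_union_add_ncard_inter _ _ (h.finite_crossings hcA) (h.finite_crossings hdA),
    ← Set.ncard_union_add_ncard_inter _ _ hfs hft]
  refine add_lt_add_of_lt_of_le ?_ (Set.ncard_le_ncard h2 (hfs.inter_of_left _))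
  refine (Set.ncard_le_ncard h1 ((hfs.union hft).sdiff)).trans_lt ?_
  exact Set.ncard_sdiff_singleton_lt_of_mem (.inl ⟨htA, hcross⟩) (hfs.union hft)

/-- Both corners distinguish profiles, so their orders are at least k; they sum to at most 2k, so
both are k. The partners P' and Q' are kept free so that the two corners may serve different pairs
or the same one. -/
lemma exists_corners (h : Admissible Ps k) (hP : P ∈ Ps) (hP' : P' ∈ Ps) (hQ : Q ∈ Ps)
    (hQ' : Q' ∈ Ps) (hs : s ∈ P) (ht : t ∈ P) (hst : s.flip ∈ P' ∨ t.flip ∈ P')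
    (hs' : s.flip ∈ Q) (ht' : t.flip ∈ Q) (hst' : s ∈ Q' ∨ t ∈ Q')
    (hcross : Separates G t.separator s.separator) :
    ∃ X ∈ sepsOf Ps P P', ∃ Y ∈ sepsOf Ps Q Q',
      (crossings Ps X).ncard + (crossings Ps Y).ncard <
        (crossings Ps s.separator).ncard + (crossings Ps t.separator).ncard := by
  have hsk := h.order_le hP hs
  have htk := h.order_le hP ht
  have hsum := (order_corner_add_order_corner_le s t).trans (add_le_add hsk htk)
  have hc := h.le_order_corner hP hP' hs ht hst
  have hd : (k : ℕ∞) ≤ (s.corner t).order :=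
    h.le_order_corner (s := s.flip) (t := t.flip) hQ hQ' hs' ht' hst'
  obtain ⟨hck, hdk⟩ := le_of_add_le_two_mul hc hd hsum
  have hcD := h.corner_distinguishes hP hP' hs ht hst hck
  have hdD : (s.corner t).Distinguishes Q Q' := 
    h.corner_distinguishes (s := s.flip) (t := t.flip) hQ hQ' hs' ht' hst' hdk
  have hcS := h.mem_sepsOf hck hcD
  have hdS := h.mem_sepsOf hdk hdD
  exact ⟨_, hcS, _, hdS, h.ncard_crossings_corner_lt
    ⟨P, hP, Q, hQ, h.mem_sepsOf hsk (.inl ⟨hs, hs'⟩)⟩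
    ⟨P, hP, Q, hQ, h.mem_sepsOf htk (.inl ⟨ht, ht'⟩)⟩
    ⟨P, hP, P', hP', hcS⟩ ⟨Q, hQ, Q', hQ', hdS⟩
    (h.nonempty hP hP' hcD).1 (h.nonempty hQ hQ' hdD).1 hcross⟩

lemma not_separates_of_optSeps (h : Admissible Ps k) (hS : S ∈ optSeps Ps)
    (hX : X ∈ optSeps Ps) : ¬ Separates G X S := by
  obtain ⟨P, hP, Q, hQ, ⟨s, rfl, hs, -, hsPQ⟩, hSmin⟩ := hS
  obtain ⟨P', hP', Q', hQ', ⟨t, rfl, ht, -, htPQ⟩, hXmin⟩ := hX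
  intro hcross
  rw [h.kappa_eq] at hs ht
  wlog h1 : s ∈ P ∧ s.flip ∈ Q generalizing s
  · exact this s.flip (by rwa [separator_flip]) (by rwa [order_flip]) hsPQ.flip
      (by rwa [separator_flip]) (hsPQ.resolve_left h1)
  wlog h2 : t ∈ P' ∧ t.flip ∈ Q' generalizing t
  · exact this t.flip (by rwa [separator_flip]) (by rwa [order_flip]) htPQ.flip
      (by rwa [separator_flip]) (htPQ.resolve_left h2)
  have hPQ : ∀ Y ∈ sepsOf Ps Q P,
      (crossings Ps s.separator).ncard ≤ (crossings Ps Y).ncard := by rwa [sepsOf_comm]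
  have hPQ' : ∀ Y ∈ sepsOf Ps Q' P',
      (crossings Ps t.separator).ncard ≤ (crossings Ps Y).ncard := by rwa [sepsOf_comm]
  obtain ⟨hsP, hsQ⟩ := h1
  obtain ⟨htP, htQ⟩ := h2
  have hs' := s.separator_flip
  have ht' := t.separator_flip
  -- In each of these four cases, one profile of each pair lies in one of two opposite corners;
  -- these corners distinguish P from Q and P' from Q', and one of them beats an optimum.
  by_cases hPP : t.flip ∈ P ∧ s.flip ∈ P'
  · obtain ⟨X, hX, Y, hY, hlt⟩ := h.exists_corners (s := s) (t := t.flip) hP hQ hP' hQ'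
      hsP hPP.1 (.inl hsQ) hPP.2 htP (.inr htQ) (by rwa [ht'])
    have := hSmin X hX
    have := hXmin Y hY
    rw [ht'] at hlt
    omega
  by_cases hPQ1 : t ∈ P ∧ s.flip ∈ Q'
  · obtain ⟨X, hX, Y, hY, hlt⟩ := h.exists_corners (s := s) (t := t) hP hQ hQ' hP'
      hsP hPQ1.1 (.inl hsQ) hPQ1.2 htQ (.inr htP) hcross
    have := hSmin X hX
    have := hPQ' Y hY
    omega
  by_cases hQP : t.flip ∈ Q ∧ s ∈ P'
  · obtain ⟨X, hX, Y, hY, hlt⟩ := h.exists_corners (s := s.flip) (t := t.flip) hQ hP hP' hQ'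
      hsQ hQP.1 (.inl hsP) hQP.2 htP (.inr htQ) (by rwa [hs', ht'])
    have := hPQ X hX
    have := hXmin Y hY
    rw [hs', ht'] at hlt
    omega
  by_cases hQQ : t ∈ Q ∧ s ∈ Q'
  · obtain ⟨X, hX, Y, hY, hlt⟩ := h.exists_corners (s := s.flip) (t := t) hQ hP hQ' hP'
      hsQ hQQ.1 (.inl hsP) hQQ.2 htQ (.inr htP) (by rwa [hs'])
    have := hPQ X hX
    have := hPQ' Y hY
    rw [hs'] at hlt
    omega
  have hP1 := h.mem_or hP ht
  have hQ1 := h.mem_or hQ ht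
  have hP1' := h.mem_or hP' hs
  have hQ1' := h.mem_or hQ' hs
  -- Once the four cases fail, any orientation of t by P determines the remaining ones in a cycle: t
  -- separates the first pair and s the second.
  have htd : t.Distinguishes P Q := by
    unfold Separation.Distinguishes
    tauto
  have hsd : s.Distinguishes P' Q' := by
    unfold Separation.Distinguishes
    tauto
  have e1 := hSmin _ (h.mem_sepsOf ht htd)
  have e2 := hXmin _ (h.mem_sepsOf hs hsd)
  -- By `e1` and `e2` the crossing numbers of s and t agree. Both corners now compete for the pair
  -- P, Q, and one has fewer crossings than s.
  rcases htd with ⟨h3, h4⟩ | ⟨h3, h4⟩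
  · obtain ⟨X, hX, Y, hY, hlt⟩ := h.exists_corners (s := s) (t := t) hP hQ hQ hP
      hsP h3 (.inl hsQ) hsQ h4 (.inl hsP) hcross
    have := hSmin X hX
    have := hPQ Y hY
    omega
  · obtain ⟨X, hX, Y, hY, hlt⟩ := h.exists_corners (s := s) (t := t.flip) hP hQ hQ hP
      hsP h3 (.inl hsQ) hsQ h4 (.inl hsP) (by rwa [ht'])
    have := hSmin X hX
    have := hPQ Y hY
    rw [ht'] at hlt
    omega

lemma mem_allSeps (hS : S ∈ optSeps Ps) : S ∈ allSeps Ps := by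
  obtain ⟨P, hP, Q, hQ, h, -⟩ := hS
  exact ⟨P, hP, Q, hQ, h⟩

lemma treeLike (h : Admissible Ps k) : TreeLike G (optSeps Ps) where
  exists_encard := ⟨k, fun _ hS => h.encard (mem_allSeps hS)⟩
  full _ hS := h.full (mem_allSeps hS)
  separates _ hS := h.separates_univ (mem_allSeps hS)
  nested _ hS _ hX := h.not_separates_of_optSeps hX hS

lemma exists_mem_optSeps (hP : P ∈ Ps) (hQ : Q ∈ Ps)
    (hne : (sepsOf Ps P Q).Nonempty) : ∃ S ∈ optSeps Ps, S ∈ sepsOf Ps P Q := by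
  obtain ⟨S, hS, hmin⟩ := WellFounded.has_min
    (measure fun S : Set V => (crossings Ps S).ncard).wf _ hne
  exact ⟨S, ⟨P, hP, Q, hQ, hS, fun X hX => not_lt.1 (hmin X hX)⟩, hS⟩

/-- If the separator of `s` is in `N` and `s` distinguishes `P` and `Q`, then so does an induced
separation of the tree-decomposition defined by `N`. -/
lemma distinguishes (h : Admissible Ps k) {N : Set (Set V)} (hN : TreeLike G N) (hP : P ∈ Ps)
    (hQ : Q ∈ Ps) (hS : s.separator ∈ N) (hs : s ∈ P) (hs' : s.flip ∈ Q) :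
    (treeDecomposition hN).Distinguishes P Q := by
  -- Principality for all members of P with this separator at once yields a vertex of the component
  -- towards which P points.
  obtain ⟨v, hv⟩ := h.isPrincipal P hP {t ∈ P | t.separator = s.separator} (fun _ ht => ht.1)
    (fun _ h1 _ h2 => h1.2.trans h2.2.symm)
  simp only [Set.mem_iInter] at hv
  have hvs := hv s ⟨hs, rfl⟩
  have hvS : v ∉ s.separator := fun h => hvs.2 h.1
  obtain ⟨b, hSb, hb⟩ := hN.exists_block hS (isComp_comp (G := G) hvS)
  set K := comp G s.separator v with hKdef
  have hvK : v ∈ K := .refl hvS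
  have hKs : K ⊆ s.right \ s.left := fun w hw => s.mem_right_sdiff_left_of_linked hw hvs
  let d : Separation G :=
    { left := s.separator ∪ K
      right := Kᶜ
      cover := by ext w; simp only [Set.mem_union, Set.mem_compl_iff, Set.mem_univ, iff_true]; tauto
      no_edge := by
        rintro a ⟨-, ha⟩ c ⟨hc, hc'⟩ hac
        have ha' : Linked G s.separator v a := Set.notMem_compl_iff.1 ha
        exact hc' (.inr (ha'.trans (.of_adj ha'.right (fun h => hc' (.inl h)) hac))) }
  have hsd : d.separator = s.separator := by
    ext w
    have : w ∈ s.separator → w ∉ K := fun h hw => Linked.right (mem_comp.1 hw) h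
    simp only [separator, d, Set.mem_inter_iff, Set.mem_union, Set.mem_compl_iff] at this ⊢
    tauto
  have hd : d.order ≤ k := by
    rw [order, hsd]
    exact h.order_le hP hs
  refine ⟨d, ⟨.inr b, .inl ⟨_, hS⟩, hSb, ?_, ?_⟩, .inr ⟨?_, ?_⟩⟩
  · rw [treeDecomposition_side hN (S := ⟨_, hS⟩) hSb, hb]
  · rw [treeDecomposition_side_symm hN (S := ⟨_, hS⟩) hSb, hb]
  -- If P contained d, the choice of v would put it outside K. For Q, consistency suffices, since d
  -- lies below `s.flip`.
  · refine (h.mem_or hP hd).resolve_left fun hdP => ?_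
    exact (hv d ⟨hdP, hsd⟩).1 hvK
  · refine (h.mem_or hQ hd).resolve_right ?_
    refine (h.isKProfile Q hQ).1.1 _ _ ⟨?_, ?_⟩ hs'
    · exact Set.union_subset Set.inter_subset_right fun w hw => (hKs hw).1
    · exact fun w hw hwK => (hKs hwK).2 hw

end Admissible

end Profiles

/-! ### Invariance of the optimal separators, and canonicity. -/

section Naturality

variable {V W : Type u} {G : SimpleGraph V} {H : SimpleGraph W}
  {Ps : Set (Set (Separation G))} {Ps' : Set (Set (Separation H))}

lemma Separation.separator_map (φ : G ≃g H) (s : Separation G) :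
    (s.map φ).separator = φ '' s.separator :=
  (Set.image_inter φ.injective).symm

lemma Separation.order_map (φ : G ≃g H) (s : Separation G) : (s.map φ).order = s.order := by
  rw [order, separator_map, φ.injective.encard_image, order]

lemma Separation.map_symm_map (φ : G ≃g H) (s : Separation G) : (s.map φ).map φ.symm = s := by
  ext v <;> simp [Separation.map]

lemma Separation.map_symm_image_map_image (φ : G ≃g H) (P : Set (Separation G)) :
    Separation.map φ.symm '' (Separation.map φ '' P) = P := by
  simp [Set.image_image, Separation.map_symm_map]

lemma Separation.Distinguishes.map (φ : G ≃g H) {s : Separation G} {P Q : Set (Separation G)}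
    (h : s.Distinguishes P Q) :
    (s.map φ).Distinguishes (Separation.map φ '' P) (Separation.map φ '' Q) :=
  h.imp (And.imp (Set.mem_image_of_mem _) (Set.mem_image_of_mem _))
    (And.imp (Set.mem_image_of_mem _) (Set.mem_image_of_mem _))

lemma profiles_symm (φ : G ≃g H) (hφ : (fun P => Separation.map φ '' P) '' Ps = Ps') :
    (fun P => Separation.map φ.symm '' P) '' Ps' = Ps := by
  rw [← hφ, Set.image_image]
  simp [Separation.map_symm_image_map_image]

lemma kappa_le_of_iso (φ : G ≃g H) (hφ : (fun P => Separation.map φ '' P) '' Ps = Ps') :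
    kappa Ps' ≤ kappa Ps := by
  refine le_sInf ?_
  rintro _ ⟨s, rfl, P, hP, Q, hQ, h⟩
  rw [← s.order_map φ]
  exact kappa_le_order (hφ ▸ ⟨P, hP, rfl⟩) (hφ ▸ ⟨Q, hQ, rfl⟩) (h.map φ)

lemma image_mem_sepsOf (φ : G ≃g H) (hφ : (fun P => Separation.map φ '' P) '' Ps = Ps')
    {P Q : Set (Separation G)} {S : Set V} (hS : S ∈ sepsOf Ps P Q) :
    φ '' S ∈ sepsOf Ps' (Separation.map φ '' P) (Separation.map φ '' Q) := by
  obtain ⟨s, rfl, h1, h2, h3⟩ := hS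
  refine ⟨s.map φ, s.separator_map φ, ?_, ?_, h3.map φ⟩
  · rw [s.order_map φ]
    exact h1.trans (kappa_le_of_iso φ.symm (profiles_symm φ hφ))
  · rwa [s.order_map φ]

lemma image_mem_allSeps (φ : G ≃g H) (hφ : (fun P => Separation.map φ '' P) '' Ps = Ps')
    {S : Set V} (hS : S ∈ allSeps Ps) : φ '' S ∈ allSeps Ps' := by
  obtain ⟨P, hP, Q, hQ, hS⟩ := hS
  exact ⟨_, hφ ▸ ⟨P, hP, rfl⟩, _, hφ ▸ ⟨Q, hQ, rfl⟩, image_mem_sepsOf φ hφ hS⟩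

lemma symm_image_image (φ : G ≃g H) (S : Set V) : φ.symm '' (φ '' S) = S := by
  simp [Set.image_image]

lemma image_symm_image (φ : G ≃g H) (S : Set W) : φ '' (φ.symm '' S) = S := by
  simp [Set.image_image]

lemma ncard_crossings_image (φ : G ≃g H) (hφ : (fun P => Separation.map φ '' P) '' Ps = Ps')
    (S : Set V) : (crossings Ps' (φ '' S)).ncard = (crossings Ps S).ncard := by
  rw [← Set.ncard_image_of_injective (crossings Ps S) (Set.image_injective.2 φ.injective)]
  congr 1
  ext Y
  constructor
  · rintro ⟨h1, h2⟩
    refine ⟨φ.symm '' Y, ⟨image_mem_allSeps φ.symm (profiles_symm φ hφ) h1, ?_⟩,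
      image_symm_image φ Y⟩
    rwa [← Separates.map_iff φ, image_symm_image]
  · rintro ⟨X, ⟨h1, h2⟩, rfl⟩
    exact ⟨image_mem_allSeps φ hφ h1, h2.map φ⟩

lemma image_mem_optSeps (φ : G ≃g H) (hφ : (fun P => Separation.map φ '' P) '' Ps = Ps')
    {S : Set V} (hS : S ∈ optSeps Ps) : φ '' S ∈ optSeps Ps' := by
  obtain ⟨P, hP, Q, hQ, hS, hmin⟩ := hS
  refine ⟨_, hφ ▸ ⟨P, hP, rfl⟩, _, hφ ▸ ⟨Q, hQ, rfl⟩, image_mem_sepsOf φ hφ hS, fun Y hY => ?_⟩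
  have hY' := image_mem_sepsOf φ.symm (profiles_symm φ hφ) hY
  simp only [Separation.map_symm_image_map_image] at hY'
  have := hmin _ hY'
  rwa [← ncard_crossings_image φ hφ, ← ncard_crossings_image φ hφ, image_symm_image] at this

lemma mem_optSeps_iff (φ : G ≃g H) (hφ : (fun P => Separation.map φ '' P) '' Ps = Ps')
    (S : Set V) : S ∈ optSeps Ps ↔ φ '' S ∈ optSeps Ps' := by
  refine ⟨image_mem_optSeps φ hφ, fun h => ?_⟩
  rw [← symm_image_image φ S]
  exact image_mem_optSeps φ.symm (profiles_symm φ hφ) h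

/-- The nested set of separators that defines the canonical tree-decomposition. -/
def treeSeps (Ps : Set (Set (Separation G))) : Set (Set V) :=
  {S ∈ optSeps Ps | TreeLike G (optSeps Ps)}

lemma treeSeps_eq (h : TreeLike G (optSeps Ps)) : treeSeps Ps = optSeps Ps :=
  Set.ext fun _ => and_iff_left h

/-- Every pair must receive a decomposition. When the optimal separators fail to be tree-like, the
empty set is used, giving a tree with a single node; this case distinction is itself invariant under
isomorphisms. -/
lemma treeLike_treeSeps (Ps : Set (Set (Separation G))) : TreeLike G (treeSeps Ps) := by
  by_cases h : TreeLike G (optSeps Ps)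
  · rwa [treeSeps_eq h]
  · have : treeSeps Ps = ∅ := Set.eq_empty_of_forall_notMem fun S hS => h hS.2
    rw [this]
    exact ⟨⟨0, by simp⟩, by simp, by simp, by simp⟩

lemma mem_treeSeps_iff (φ : G ≃g H) (hφ : (fun P => Separation.map φ '' P) '' Ps = Ps')
    (S : Set V) : S ∈ treeSeps Ps ↔ φ '' S ∈ treeSeps Ps' :=
  and_congr (mem_optSeps_iff φ hφ S)
    ⟨TreeLike.map φ (mem_optSeps_iff φ hφ),
      TreeLike.map φ.symm (mem_optSeps_iff φ.symm (profiles_symm φ hφ))⟩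

/-- The canonical tree-decomposition of a pair `(G, Ps)`. -/
def canonicalDecomposition (X : ProfiledGraph.{u}) : TreeDecomposition X.graph :=
  treeDecomposition (treeLike_treeSeps X.profiles)

lemma isCanonical_canonicalDecomposition : IsCanonical canonicalDecomposition.{u} := by
  refine ⟨fun X Y φ => sepTreeIso φ.toIso (mem_treeSeps_iff φ.toIso φ.map_profiles), ?_, ?_, ?_⟩
  · exact fun X Y φ t =>
      nodeBag_nodeMap φ.toIso (mem_treeSeps_iff φ.toIso φ.map_profiles) t
  · exact fun X => RelIso.ext fun t => nodeMap_eq_self _ (fun _ => rfl)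
      (mem_treeSeps_iff _ (ProfiledGraph.Iso.refl X).map_profiles) t
  · exact fun X Y Z φ χ => RelIso.ext fun t =>
      (nodeMap_nodeMap φ.toIso χ.toIso _ (fun _ => rfl)
        (mem_treeSeps_iff φ.toIso φ.map_profiles) (mem_treeSeps_iff χ.toIso χ.map_profiles)
        (mem_treeSeps_iff _ (φ.trans χ).map_profiles) t).symm

end Naturality

end GraphSep

theorem theorem5p1 :
    ∃ ψ : (X : GraphSep.ProfiledGraph.{u}) → GraphSep.TreeDecomposition X.graph,
      GraphSep.IsCanonical ψ ∧
      ∀ {V : Type u} (G : SimpleGraph V) (Ps : Set (Set (GraphSep.Separation G))) (k : ℕ),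
        (k : ℕ∞) = GraphSep.kappa Ps →
        (∀ P ∈ Ps, GraphSep.IsKProfile (k + 1) P ∧ GraphSep.IsPrincipal P ∧
          GraphSep.IsRobust P) →
        GraphSep.WellSeparable Ps →
        (∀ P ∈ Ps, ∀ Q ∈ Ps, GraphSep.Distinguishable k P Q →
          (ψ ⟨V, G, Ps⟩).Distinguishes P Q) ∧
        (ψ ⟨V, G, Ps⟩).IsBalanced k := by
  refine ⟨GraphSep.canonicalDecomposition, GraphSep.isCanonical_canonicalDecomposition, ?_⟩
  intro V G Ps k hk hPs hG
  have h : GraphSep.Admissible Ps k :=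
    ⟨hk.symm, fun P hP => (hPs P hP).1, fun P hP => (hPs P hP).2.1, hG⟩
  refine ⟨fun P hP Q hQ => ?_, ?_⟩
  · rintro ⟨r, hr, hrPQ⟩
    -- The given r only shows that the pair has a separator of order k; an optimal one for the same
    -- pair replaces it.
    obtain ⟨S, hS, s, rfl, -, -, hs⟩ :=
      GraphSep.Admissible.exists_mem_optSeps hP hQ ⟨_, h.mem_sepsOf hr hrPQ⟩
    rw [← GraphSep.treeSeps_eq h.treeLike] at hS
    rcases hs with ⟨h1, h2⟩ | ⟨h1, h2⟩
    · exact h.distinguishes (GraphSep.treeLike_treeSeps Ps) hP hQ hS h1 h2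
    · exact h.distinguishes (s := s.flip) (GraphSep.treeLike_treeSeps Ps) hP hQ
        (by rwa [s.separator_flip]) h1 h2
  · refine GraphSep.treeDecomposition_isBalanced (GraphSep.treeLike_treeSeps Ps) fun S hS => ?_
    exact h.encard (GraphSep.Admissible.mem_allSeps hS.1)
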